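/- Let $k$ be an algebraically closed field of characteristic $0$, and let $L$ be the $k$-algebra generated by $a,b,c,z,w$ subject to the relations $$[a,b]=c,\qquad [z,w]=\tfrac13 c^3,\qquad [a,c]=[a,z]=[a,w]=[b,c]=[b,z]=[b,w]=[c,z]=[c,w]=0 .$$ There is a Hopf algebra structure on $L$ whose coproduct $\Delta$, counit $\epsilon$ and antipode $S$ satisfy $$\Delta(x)=1\otimes x+x\otimes 1\quad (x=a,b,c),$$ $$\Delta(z)=1\otimes z+a\otimes c-c\otimes a+z\otimes 1,\qquad \Delta(w)=1\otimes w+b\otimes c-c\otimes b+w\otimes 1,$$ and $\epsilon(x)=0$, $S(x)=-x$ for $x\in\{a,b,c,z,w\}$; it is not cocommutative. With this structure the following hold. 1. $L$ is a connected Hopf algebra, i.e. its coradical (the sum of all simple subcoalgebras) is $k$. 2. $L$ is connected graded as an algebra, i.e. $L=\bigoplus_{i\ge 0}L(i)$ is $\mathbb N$-graded as an algebra with $L(0)=k$, and it is a graded Hopf algebra with respect to the same grading, i.e. $\Delta(L(m))\subseteq\sum_{i=0}^{m}L(i)\otimes L(m-i)$ and $S(L(m))\subseteq L(m)$ for all $m\ge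 0$, and $\epsilon(L(m))=0$ for all $m\ge 1$. 3. As a $k$-algebra, $L$ is not isomorphic to the universal enveloping algebra $U(\mathfrak n)$ of any Lie algebra $\mathfrak n$ over $k$ (of finite or infinite dimension). 4. $L$ is an iterated Hopf Ore extension: there is a finite chain $k=L_{(0)}\subseteq L_{(1)}\subseteq\cdots\subseteq L_{(n)}=L$ of Hopf subalgebras such that each $L_{(i+1)}$ is an Ore extension $L_{(i)}[x_{i+1};\sigma_{i+1},\delta_{i+1}]$, with $\sigma_{i+1}$ an algebra automorphism and $\delta_{i+1}$ a $\sigma_{i+1}$-derivation of $L_{(i)}$. 5. The Gelfand–Kirillov dimension of $L$ is $5$. 6. The signature of $L$ is $(1,1,1,2,2)$, i.e. the coradical filtration $L_0\subseteq L_1\subseteq\cdots$, defined by $L_0$ being the coradical and $L_{i}=\Delta^{-1}(L\otimes L_{i-1}+L_0\otimes L)$ for $i\ge1$, is an algebra filtration, and its associated graded algebra $\bigoplus_{i\ge 0}L_i/L_{i-1}$ (with $L_{-1}=0$) is isomorphic as a graded algebra to the commutative polynomial algebra $k[x_1,\dots,x_5]$ with $\deg x_1=\deg x_2=\deg x_3=1$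 and $\deg x_4=\deg x_5=2$. 7. The centre of $L$ is $k[c]$, the polynomial algebra in $c$. -/

import Mathlib

open scoped TensorProduct DirectSum

universe u v

noncomputable section

/-! ### Coradical, coradical filtration, connectedness -/

namespace ConnectedHopf

section Coalgebra

variable (k : Type u) {C : Type v} [Field k] [AddCommGroup C] [Module k C]

/-- The subspace `D ⊗ E` of `C ⊗ C`. -/
def tensorSub (D E : Submodule k C) : Submodule k (C ⊗[k] C) :=
  LinearMap.range (TensorProduct.map D.subtype E.subtype)

variable [Coalgebra k C]

/-- `D` is a subcoalgebra: `Δ(D) ⊆ D ⊗ D`. -/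
def IsSubcoalgebra (D : Submodule k C) : Prop :=
  D.map (Coalgebra.comul (R := k) (A := C)) ≤ tensorSub k D D

/-- `D` is a simple subcoalgebra: nonzero, without proper nonzero subcoalgebras. -/
def IsSimpleSubcoalgebra (D : Submodule k C) : Prop :=
  IsSubcoalgebra k D ∧ D ≠ ⊥ ∧ ∀ E : Submodule k C, IsSubcoalgebra k E → E ≤ D → E = ⊥ ∨ E = D

variable (C)

/-- The coradical: the sum of all simple subcoalgebras. -/
def coradical : Submodule k C :=
  sSup {D : Submodule k C | IsSimpleSubcoalgebra k D}

/-- The coradical filtration: `C₀` is the coradical and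
`Cₙ₊₁ = Δ⁻¹(C ⊗ Cₙ + C₀ ⊗ C)`. -/
def coradicalFiltration : ℕ → Submodule k C
  | 0 => coradical k C
  | n + 1 => (tensorSub k ⊤ (coradicalFiltration n) ⊔ tensorSub k (coradical k C) ⊤).comap
      (Coalgebra.comul (R := k) (A := C))

/-- The preceding term of the coradical filtration, with `C₋₁ = 0`. -/
def coradicalFiltrationPrev : ℕ → Submodule k C
  | 0 => ⊥
  | n + 1 => coradicalFiltration k C n

end Coalgebra

/-- A Hopf algebra is connected if its coradical is `k`. -/
def IsConnected (k : Type u) (H : Type v) [Field k] [Ring H] [HopfAlgebra k H] : Prop :=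
  coradical k H = (1 : Submodule k H)

/-! ### Gradings -/

/-- `𝒜` makes `A` a connected `ℕ`-graded algebra: `A = ⨁ 𝒜 n`, `1 ∈ 𝒜 0`,
`𝒜 m * 𝒜 n ⊆ 𝒜 (m + n)` and `𝒜 0 = k`. -/
structure IsConnectedGradedAlgebra {k : Type u} {A : Type v} [Field k] [Ring A] [Algebra k A]
    (𝒜 : ℕ → Submodule k A) : Prop where
  gradedMonoid : SetLike.GradedMonoid 𝒜
  isInternal : DirectSum.IsInternal 𝒜
  zero_eq : 𝒜 0 = 1

/-- `𝒜` is compatible with the coalgebra structure and the antipode. -/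
structure IsHopfGrading {k : Type u} {H : Type v} [Field k] [Ring H] [HopfAlgebra k H]
    (𝒜 : ℕ → Submodule k H) : Prop where
  comul_mem : ∀ m, ∀ x ∈ 𝒜 m, Coalgebra.comul (R := k) x ∈
    ⨆ (i : ℕ) (j : ℕ) (_ : i + j = m), tensorSub k (𝒜 i) (𝒜 j)
  counit_eq_zero : ∀ m, m ≠ 0 → ∀ x ∈ 𝒜 m, Coalgebra.counit (R := k) x = 0
  antipode_mem : ∀ m, ∀ x ∈ 𝒜 m, HopfAlgebra.antipode k x ∈ 𝒜 m

/-! ### Iterated Hopf Ore extensions -/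

/-- `T = R[x; σ, δ]` inside an ambient algebra, for some automorphism `σ` of `R`, some
`σ`-derivation `δ` of `R` and some `x ∈ T`: one has `x r = σ(r) x + δ(r)` for `r ∈ R`, and every
element of `T` is uniquely `∑ rⱼ xʲ` with `rⱼ ∈ R`. -/
def IsOreExtension {k : Type u} {A : Type v} [Field k] [Ring A] [Algebra k A]
    (R T : Subalgebra k A) : Prop :=
  ∃ (σ : R ≃ₐ[k] R) (δ : R →ₗ[k] R) (x : A),
    (∀ r s : R, δ (r * s) = σ r * δ s + δ r * s) ∧
    (∀ r : R, x * (r : A) = (σ r : A) * x + (δ r : A)) ∧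
    Function.Injective (fun f : ℕ →₀ R => f.sum fun j r => (r : A) * x ^ j) ∧
    Set.range (fun f : ℕ →₀ R => f.sum fun j r => (r : A) * x ^ j) = (T : Set A)

/-- A subalgebra closed under comultiplication and antipode. -/
def IsHopfSubalgebra {k : Type u} {H : Type v} [Field k] [Ring H] [HopfAlgebra k H]
    (B : Subalgebra k H) : Prop :=
  IsSubcoalgebra k (Subalgebra.toSubmodule B) ∧ ∀ x ∈ B, HopfAlgebra.antipode k x ∈ B

/-- An iterated Hopf Ore extension: there is a chain `k = H₍₀₎ ⊆ ⋯ ⊆ H₍ₙ₎ = H` of Hopf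
subalgebras, each an Ore extension of the preceding one. -/
def IsIHOE (k : Type u) (H : Type v) [Field k] [Ring H] [HopfAlgebra k H] : Prop :=
  ∃ (n : ℕ) (B : ℕ → Subalgebra k H), B 0 = ⊥ ∧ B n = ⊤ ∧
    (∀ i ≤ n, IsHopfSubalgebra (B i)) ∧ ∀ i < n, IsOreExtension (B i) (B (i + 1))

/-! ### Gelfand–Kirillov dimension -/

/-- `sup_V limsup_n log_n dim (k + V + ⋯ + Vⁿ)`, over the finite-dimensional subspaces `V`. -/
def GKdim (k : Type u) (A : Type v) [Field k] [Ring A] [Algebra k A] : EReal :=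
  ⨆ (V : Submodule k A) (_ : FiniteDimensional k V),
    Filter.limsup (fun n : ℕ =>
      ((Real.log (Module.finrank k (⨆ i ∈ Finset.range (n + 1), V ^ i : Submodule k A)) /
        Real.log n : ℝ) : EReal)) Filter.atTop

/-! ### Associated graded algebra and signature -/

section AssociatedGraded

variable {k : Type u} {A : Type v} [Field k] [Ring A] [Algebra k A]

/-- The degree `n` piece `F n / F (n - 1)`; the second family is `n ↦ F (n - 1)`. -/
def GrPiece (F Flt : ℕ → Submodule k A) (n : ℕ) : Type v :=
  F n ⧸ (Flt n).submoduleOf (F n)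

variable (F Flt : ℕ → Submodule k A)

instance (n : ℕ) : AddCommGroup (GrPiece F Flt n) :=
  inferInstanceAs (AddCommGroup (F n ⧸ (Flt n).submoduleOf (F n)))

instance (n : ℕ) : Module k (GrPiece F Flt n) :=
  inferInstanceAs (Module k (F n ⧸ (Flt n).submoduleOf (F n)))

/-- The symbol map `F n → F n / F (n - 1)`. -/
def GrPiece.mk (n : ℕ) : F n →ₗ[k] GrPiece F Flt n :=
  ((Flt n).submoduleOf (F n)).mkQ

theorem GrPiece.mk_surjective (n : ℕ) : Function.Surjective (GrPiece.mk F Flt n) :=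
  Submodule.mkQ_surjective _

theorem GrPiece.mk_eq_zero {n : ℕ} {x : F n} (hx : (x : A) ∈ Flt n) :
    GrPiece.mk F Flt n x = 0 :=
  (Submodule.Quotient.mk_eq_zero _).2 hx

variable {F Flt}

theorem GrPiece.gradedMk_eq {i j : ℕ} (x : F i) (y : F j) (hij : i = j) (h : (x : A) = y) :
    (GradedMonoid.mk i (GrPiece.mk F Flt i x) : GradedMonoid (GrPiece F Flt)) =
      GradedMonoid.mk j (GrPiece.mk F Flt j y) := by
  subst hij
  rw [Subtype.ext h]

variable [hF : IsRingFiltration F Flt]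

theorem lt_mul_mem {i j : ℕ} {x y : A} (hx : x ∈ Flt i) (hy : y ∈ F j) :
    x * y ∈ Flt (i + j) := by
  have h : Flt i ≤ (Flt (i + j)).comap (LinearMap.mulRight k y) := by
    refine IsFiltration.is_sup (F := F) _ i fun l hl z hz => ?_
    exact IsFiltration.is_le (F := F) (Nat.add_lt_add_right hl j) (SetLike.mul_mem_graded hz hy)
  exact h hx

theorem mul_lt_mem {i j : ℕ} {x y : A} (hx : x ∈ F i) (hy : y ∈ Flt j) :
    x * y ∈ Flt (i + j) := by
  have h : Flt j ≤ (Flt (i + j)).comap (LinearMap.mulLeft k x) := by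
    refine IsFiltration.is_sup (F := F) _ j fun l hl z hz => ?_
    exact IsFiltration.is_le (F := F) (Nat.add_lt_add_left hl i) (SetLike.mul_mem_graded hx hz)
  exact h hy

variable (F Flt)

/-- The product `F i × F j → F (i + j) / F (i + j - 1)`. -/
def GrPiece.preMul (i j : ℕ) : F i →ₗ[k] F j →ₗ[k] GrPiece F Flt (i + j) :=
  LinearMap.mk₂ k
    (fun x y => GrPiece.mk F Flt (i + j) ⟨(x : A) * y, SetLike.mul_mem_graded x.2 y.2⟩)
    (fun x x' y => by
      rw [← map_add]; congr 1; ext; simp [add_mul])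
    (fun r x y => by
      rw [← map_smul]; congr 1; ext; simp)
    (fun x y y' => by
      rw [← map_add]; congr 1; ext; simp [mul_add])
    (fun r x y => by
      rw [← map_smul]; congr 1; ext; simp)

/-- The product of the associated graded algebra, induced by that of `A`. -/
def GrPiece.mulMap (i j : ℕ) :
    GrPiece F Flt i →ₗ[k] GrPiece F Flt j →ₗ[k] GrPiece F Flt (i + j) :=
  Submodule.liftQ _
    (LinearMap.flip (Submodule.liftQ _ (GrPiece.preMul F Flt i j).flip (by
      intro y hy
      rw [LinearMap.mem_ker]
      ext x
      exact GrPiece.mk_eq_zero F Flt (mul_lt_mem x.2 hy))))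
    (by
      intro x hx
      rw [LinearMap.mem_ker]
      refine LinearMap.ext fun y => ?_
      obtain ⟨y, rfl⟩ := GrPiece.mk_surjective F Flt j y
      exact GrPiece.mk_eq_zero F Flt (lt_mul_mem hx y.2))

theorem GrPiece.mulMap_mk {i j : ℕ} (x : F i) (y : F j) :
    GrPiece.mulMap F Flt i j (GrPiece.mk F Flt i x) (GrPiece.mk F Flt j y) =
      GrPiece.mk F Flt (i + j) ⟨(x : A) * y, SetLike.mul_mem_graded x.2 y.2⟩ :=
  rfl

instance : GradedMonoid.GOne (GrPiece F Flt) where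
  one := GrPiece.mk F Flt 0 ⟨1, SetLike.one_mem_graded F⟩

instance : GradedMonoid.GMul (GrPiece F Flt) where
  mul {i j} x y := GrPiece.mulMap F Flt i j x y

instance : DirectSum.GRing (GrPiece F Flt) where
  mul_zero x := map_zero _
  zero_mul y := LinearMap.map_zero₂ _ _
  mul_add x y z := map_add _ _ _
  add_mul x y z := LinearMap.map_add₂ _ _ _ _
  one_mul := by
    rintro ⟨i, x⟩
    obtain ⟨x, rfl⟩ := GrPiece.mk_surjective F Flt i x
    exact GrPiece.gradedMk_eq _ _ (zero_add i) (one_mul _)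
  mul_one := by
    rintro ⟨i, x⟩
    obtain ⟨x, rfl⟩ := GrPiece.mk_surjective F Flt i x
    exact GrPiece.gradedMk_eq _ _ (add_zero i) (mul_one _)
  mul_assoc := by
    rintro ⟨i, x⟩ ⟨j, y⟩ ⟨l, z⟩
    obtain ⟨x, rfl⟩ := GrPiece.mk_surjective F Flt i x
    obtain ⟨y, rfl⟩ := GrPiece.mk_surjective F Flt j y
    obtain ⟨z, rfl⟩ := GrPiece.mk_surjective F Flt l z
    exact GrPiece.gradedMk_eq _ _ (add_assoc i j l) (mul_assoc _ _ _)
  natCast n := n • GrPiece.mk F Flt 0 ⟨1, SetLike.one_mem_graded F⟩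
  natCast_zero := zero_smul _ _
  natCast_succ n := succ_nsmul _ _
  intCast n := n • GrPiece.mk F Flt 0 ⟨1, SetLike.one_mem_graded F⟩
  intCast_ofNat n := natCast_zsmul _ _
  intCast_negSucc_ofNat n := negSucc_zsmul _ _

instance : DirectSum.GAlgebra k (GrPiece F Flt) where
  toFun := (LinearMap.toSpanSingleton k _
    (GrPiece.mk F Flt 0 ⟨1, SetLike.one_mem_graded F⟩)).toAddMonoidHom
  map_one := one_smul k (GrPiece.mk F Flt 0 ⟨1, SetLike.one_mem_graded F⟩)
  map_mul r s := GrPiece.gradedMk_eq (F := F) (Flt := Flt) ((r * s) • ⟨1, _⟩)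
    ⟨(r • (1 : A)) * (s • (1 : A)), SetLike.mul_mem_graded
      (Submodule.smul_mem _ _ (SetLike.one_mem_graded F))
      (Submodule.smul_mem _ _ (SetLike.one_mem_graded F))⟩ rfl (by simp [smul_smul, mul_comm r s])
  commutes r := by
    rintro ⟨i, x⟩
    obtain ⟨x, rfl⟩ := GrPiece.mk_surjective F Flt i x
    exact GrPiece.gradedMk_eq (F := F) (Flt := Flt)
      ⟨(r • (1 : A)) * x, SetLike.mul_mem_graded
        (Submodule.smul_mem _ _ (SetLike.one_mem_graded F)) x.2⟩
      ⟨x * (r • (1 : A)), SetLike.mul_mem_graded x.2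
        (Submodule.smul_mem _ _ (SetLike.one_mem_graded F))⟩ (add_comm _ _) (by simp)
  smul_def r := by
    rintro ⟨i, x⟩
    obtain ⟨x, rfl⟩ := GrPiece.mk_surjective F Flt i x
    exact GrPiece.gradedMk_eq (F := F) (Flt := Flt) (r • x)
      ⟨(r • (1 : A)) * x, SetLike.mul_mem_graded
        (Submodule.smul_mem _ _ (SetLike.one_mem_graded F)) x.2⟩ (zero_add _).symm (by simp)

end AssociatedGraded

/-- `H` has signature `(d₁, …, dₙ)`: the coradical filtration is an algebra filtration, and its
associated graded algebra is isomorphic, as a graded algebra, to the commutative polynomial algebra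
`k[x₁, …, xₙ]` with `deg xᵢ = dᵢ`. -/
def HasSignature (k : Type u) (H : Type v) [Field k] [Ring H] [HopfAlgebra k H]
    {n : ℕ} (d : Fin n → ℕ) : Prop :=
  ∃ (_ : IsRingFiltration (coradicalFiltration k H) (coradicalFiltrationPrev k H))
    (e : (⨁ m, GrPiece (coradicalFiltration k H) (coradicalFiltrationPrev k H) m) ≃ₐ[k]
      MvPolynomial (Fin n) k),
    ∀ (m : ℕ) (x : GrPiece (coradicalFiltration k H) (coradicalFiltrationPrev k H) m),
      MvPolynomial.IsWeightedHomogeneous d (e (DirectSum.of _ m x)) m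

/-! ### The algebra `L` -/

/-- The generators of `L`. -/
inductive Gen
  | a | b | c | z | w

section L

variable (k : Type u) [Field k]

/-- A generator, in the free algebra. -/
def free (g : Gen) : FreeAlgebra k Gen := FreeAlgebra.ι k g

open Gen in
/-- The defining relations of `L`: `[a,b] = c`, `[z,w] = c³/3`, all other pairs of generators
commute. -/
inductive LRel : FreeAlgebra k Gen → FreeAlgebra k Gen → Prop
  | ab : LRel (free k a * free k b - free k b * free k a) (free k c)
  | zw : LRel (free k z * free k w - free k w * free k z) ((3 : k)⁻¹ • free k c ^ 3)
  | ac : LRel (free k a * free k c) (free k c * free k a)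
  | az : LRel (free k a * free k z) (free k z * free k a)
  | aw : LRel (free k a * free k w) (free k w * free k a)
  | bc : LRel (free k b * free k c) (free k c * free k b)
  | bz : LRel (free k b * free k z) (free k z * free k b)
  | bw : LRel (free k b * free k w) (free k w * free k b)
  | cz : LRel (free k c * free k z) (free k z * free k c)
  | cw : LRel (free k c * free k w) (free k w * free k c)

/-- The algebra `L`, by generators and relations. -/
def L : Type u := RingQuot (LRel k)

namespace L

instance : Ring (L k) := inferInstanceAs (Ring (RingQuot (LRel k)))

instance : Algebra k (L k) := inferInstanceAs (Algebra k (RingQuot (LRel k)))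

/-- The canonical projection from the free algebra. -/
def proj : FreeAlgebra k Gen →ₐ[k] L k := RingQuot.mkAlgHom k (LRel k)

/-- A generator, as an element of `L`. -/
def gen (g : Gen) : L k := proj k (free k g)

/-- The generator `a`. -/
abbrev a : L k := gen k Gen.a

/-- The generator `b`. -/
abbrev b : L k := gen k Gen.b

/-- The generator `c`. -/
abbrev c : L k := gen k Gen.c

/-- The generator `z`. -/
abbrev z : L k := gen k Gen.z

/-- The generator `w`. -/
abbrev w : L k := gen k Gen.w

variable {k}

theorem proj_rel {x y : FreeAlgebra k Gen} (h : LRel k x y) : proj k x = proj k y :=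
  RingQuot.mkAlgHom_rel k h

theorem ba : b k * a k = a k * b k - c k := by
  have h := proj_rel (LRel.ab (k := k))
  rw [map_sub, map_mul, map_mul] at h
  exact eq_sub_iff_add_eq.2 (sub_eq_iff_eq_add'.1 h).symm

theorem wz : w k * z k = z k * w k - (3 : k)⁻¹ • c k ^ 3 := by
  have h := proj_rel (LRel.zw (k := k))
  rw [map_sub, map_mul, map_mul, map_smul, map_pow] at h
  exact eq_sub_iff_add_eq.2 (sub_eq_iff_eq_add'.1 h).symm

theorem ca : c k * a k = a k * c k := by
  simpa only [map_mul] using! (proj_rel (LRel.ac (k := k))).symm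

theorem za : z k * a k = a k * z k := by
  simpa only [map_mul] using! (proj_rel (LRel.az (k := k))).symm

theorem wa : w k * a k = a k * w k := by
  simpa only [map_mul] using! (proj_rel (LRel.aw (k := k))).symm

theorem cb : c k * b k = b k * c k := by
  simpa only [map_mul] using! (proj_rel (LRel.bc (k := k))).symm

theorem zb : z k * b k = b k * z k := by
  simpa only [map_mul] using! (proj_rel (LRel.bz (k := k))).symm

theorem wb : w k * b k = b k * w k := by
  simpa only [map_mul] using! (proj_rel (LRel.bw (k := k))).symm

theorem zc : z k * c k = c k * z k := by
  simpa only [map_mul] using! (proj_rel (LRel.cz (k := k))).symm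

theorem wc : w k * c k = c k * w k := by
  simpa only [map_mul] using! (proj_rel (LRel.cw (k := k))).symm

/-- The homomorphism from `L` determined by the images of the generators. -/
def lift {B : Type v} [Ring B] [Algebra k B] (f : Gen → B)
    (h : ∀ ⦃x y⦄, LRel k x y → FreeAlgebra.lift k f x = FreeAlgebra.lift k f y) : L k →ₐ[k] B :=
  RingQuot.liftAlgHom k ⟨FreeAlgebra.lift k f, h⟩

@[simp]
theorem lift_gen {B : Type v} [Ring B] [Algebra k B] (f : Gen → B)
    (h : ∀ ⦃x y⦄, LRel k x y → FreeAlgebra.lift k f x = FreeAlgebra.lift k f y) (g : Gen) :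
    lift f h (gen k g) = f g := by
  have h1 := RingQuot.liftAlgHom_mkAlgHom_apply k (FreeAlgebra.lift k f) h (free k g)
  exact h1.trans (FreeAlgebra.lift_ι_apply f g)

theorem algHom_ext {B : Type v} [Semiring B] [Algebra k B] {f f' : L k →ₐ[k] B}
    (h : ∀ g, f (gen k g) = f' (gen k g)) : f = f' := by
  refine RingQuot.ringQuot_ext' k (s := LRel k) f f' ?_
  ext g
  exact h g

theorem induction {P : L k → Prop} (halg : ∀ r, P (algebraMap k (L k) r))
    (hgen : ∀ g, P (gen k g)) (hmul : ∀ x y, P x → P y → P (x * y))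
    (hadd : ∀ x y, P x → P y → P (x + y)) (x : L k) : P x := by
  obtain ⟨y, rfl⟩ : ∃ y, proj k y = x := RingQuot.mkAlgHom_surjective k (LRel k) x
  induction y using FreeAlgebra.induction with
  | grade0 r => simpa using halg r
  | grade1 g => exact hgen g
  | mul x y hx hy => simpa using hmul _ _ hx hy
  | add x y hx hy => simpa using hadd _ _ hx hy

/-- The values of the coproduct on the generators. -/
def comulGen : Gen → L k ⊗[k] L k
  | .a => 1 ⊗ₜ a k + a k ⊗ₜ 1
  | .b => 1 ⊗ₜ b k + b k ⊗ₜ 1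
  | .c => 1 ⊗ₜ c k + c k ⊗ₜ 1
  | .z => 1 ⊗ₜ z k + a k ⊗ₜ c k - c k ⊗ₜ a k + z k ⊗ₜ 1
  | .w => 1 ⊗ₜ w k + b k ⊗ₜ c k - c k ⊗ₜ b k + w k ⊗ₜ 1

variable [CharZero k]

/-- The coproduct, as an algebra homomorphism. -/
def comulHom : L k →ₐ[k] L k ⊗[k] L k :=
  lift comulGen (by
    intro x y h
    cases h <;>
    simp only [free, map_sub, map_mul, map_smul, FreeAlgebra.lift_ι_apply, comulGen,
      pow_succ, pow_zero, one_mul, mul_one, mul_add, add_mul, mul_sub, sub_mul,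
      Algebra.TensorProduct.tmul_mul_tmul, ba, wz, ca, za, wa, cb, zb, wb, zc, wc,
      TensorProduct.sub_tmul, TensorProduct.tmul_sub, TensorProduct.tmul_smul,
      ← TensorProduct.smul_tmul'] <;> module)

/-- The counit, as an algebra homomorphism. -/
def counitHom : L k →ₐ[k] k :=
  lift (fun _ => 0) (by
    intro x y h
    cases h <;> simp [free])

/-- The antipode, as an algebra homomorphism to the opposite algebra. -/
def antipodeHom : L k →ₐ[k] (L k)ᵐᵒᵖ :=
  lift (fun g => MulOpposite.op (-gen k g)) (by
    intro x y h
    cases h <;>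
    simp only [free, map_sub, map_mul, map_smul, map_pow, FreeAlgebra.lift_ι_apply,
      ← MulOpposite.op_mul, ← MulOpposite.op_sub, ← MulOpposite.op_pow, ← MulOpposite.op_smul,
      neg_mul_neg] <;>
    congr 1 <;>
    simp only [pow_succ, pow_zero, one_mul, neg_mul, mul_neg,
      ba, wz, ca, za, wa, cb, zb, wb, zc, wc] <;> module)

instance : Bialgebra k (L k) :=
  Bialgebra.ofAlgHom comulHom counitHom
    (algHom_ext fun g => by
      cases g <;>
      simp [comulHom, comulGen, Algebra.TensorProduct.one_def, TensorProduct.add_tmul,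
        TensorProduct.tmul_add, TensorProduct.sub_tmul, TensorProduct.tmul_sub] <;> abel)
    (algHom_ext fun g => by
      cases g <;> simp [comulHom, comulGen, counitHom])
    (algHom_ext fun g => by
      cases g <;> simp [comulHom, comulGen, counitHom])

@[simp]
theorem comul_gen (g : Gen) : Coalgebra.comul (R := k) (gen k g) = comulGen g :=
  lift_gen comulGen _ g

@[simp]
theorem counit_gen (g : Gen) : Coalgebra.counit (R := k) (gen k g) = 0 :=
  lift_gen (fun _ => (0 : k)) _ g

/-- The antipode, as a linear map. -/
def antipodeLin : L k →ₗ[k] L k :=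
  (MulOpposite.opLinearEquiv k).symm.toLinearMap ∘ₗ antipodeHom.toLinearMap

@[simp]
theorem antipodeLin_gen (g : Gen) : antipodeLin (gen k g) = -gen k g := by
  simp [antipodeLin, antipodeHom]

theorem antipodeLin_one : antipodeLin (1 : L k) = 1 := by
  simp [antipodeLin]

theorem antipodeLin_mul (x y : L k) :
    antipodeLin (x * y) = antipodeLin y * antipodeLin x := by
  simp [antipodeLin]

theorem antipode_left_aux (x : L k)
    (hx : LinearMap.mul' k (L k) (antipodeLin.rTensor (L k) (Coalgebra.comul (R := k) x)) =
      algebraMap k (L k) (Coalgebra.counit x)) (t : L k ⊗[k] L k) :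
    LinearMap.mul' k (L k) (antipodeLin.rTensor (L k) (Coalgebra.comul (R := k) x * t)) =
      Coalgebra.counit (R := k) x • LinearMap.mul' k (L k) (antipodeLin.rTensor (L k) t) := by
  induction t with
  | zero => simp
  | add t t' h h' => rw [mul_add, map_add, map_add, h, h', map_add, map_add, smul_add]
  | tmul y y' =>
    have key : ∀ s : L k ⊗[k] L k,
        LinearMap.mul' k (L k) (antipodeLin.rTensor (L k) (s * y ⊗ₜ y')) =
          antipodeLin y * LinearMap.mul' k (L k) (antipodeLin.rTensor (L k) s) * y' := by
      intro s
      induction s with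
      | zero => simp
      | add s s' h h' => simp only [add_mul, map_add, h, h', mul_add]
      | tmul x x' => simp [antipodeLin_mul, mul_assoc]
    rw [key, hx]
    simp [Algebra.algebraMap_eq_smul_one]

theorem antipode_right_aux (y : L k)
    (hy : LinearMap.mul' k (L k) (antipodeLin.lTensor (L k) (Coalgebra.comul (R := k) y)) =
      algebraMap k (L k) (Coalgebra.counit y)) (t : L k ⊗[k] L k) :
    LinearMap.mul' k (L k) (antipodeLin.lTensor (L k) (t * Coalgebra.comul (R := k) y)) =
      Coalgebra.counit (R := k) y • LinearMap.mul' k (L k) (antipodeLin.lTensor (L k) t) := by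
  induction t with
  | zero => simp
  | add t t' h h' => rw [add_mul, map_add, map_add, h, h', map_add, map_add, smul_add]
  | tmul x x' =>
    have key : ∀ s : L k ⊗[k] L k,
        LinearMap.mul' k (L k) (antipodeLin.lTensor (L k) (x ⊗ₜ x' * s)) =
          x * LinearMap.mul' k (L k) (antipodeLin.lTensor (L k) s) * antipodeLin x' := by
      intro s
      induction s with
      | zero => simp
      | add s s' h h' => simp only [add_mul, map_add, h, h', mul_add]
      | tmul y y' => simp [antipodeLin_mul, mul_assoc]
    rw [key, hy]
    simp [Algebra.algebraMap_eq_smul_one]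

instance : HopfAlgebra k (L k) where
  antipode := antipodeLin
  mul_antipode_rTensor_comul := by
    refine LinearMap.ext fun x => ?_
    induction x using L.induction with
    | halg r =>
      simp [Algebra.algebraMap_eq_smul_one, antipodeLin_one, Algebra.TensorProduct.one_def]
    | hgen g =>
      cases g <;> simp [comulGen, antipodeLin_one, ca, cb]
    | hmul x y hx hy =>
      simp only [LinearMap.comp_apply] at hx hy ⊢
      rw [Bialgebra.comul_mul, antipode_left_aux x hx, hy, Bialgebra.counit_mul]
      simp [Algebra.smul_def]
    | hadd x y hx hy => rw [map_add, hx, hy, map_add]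
  mul_antipode_lTensor_comul := by
    refine LinearMap.ext fun x => ?_
    induction x using L.induction with
    | halg r =>
      simp [Algebra.algebraMap_eq_smul_one, antipodeLin_one, Algebra.TensorProduct.one_def]
    | hgen g =>
      cases g <;> simp [comulGen, antipodeLin_one, ca, cb]
    | hmul x y hx hy =>
      simp only [LinearMap.comp_apply] at hx hy ⊢
      rw [Bialgebra.comul_mul, antipode_right_aux y hy, hx, Bialgebra.counit_mul]
      simp [Algebra.algebraMap_eq_smul_one, smul_smul, mul_comm]
    | hadd x y hx hy => rw [map_add, hx, hy, map_add]

end L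

end L

end ConnectedHopf

end

noncomputable section

namespace ConnectedHopf

namespace L

open MvPolynomial

variable (k : Type u) [Field k]

/-! ### The Poincaré–Birkhoff–Witt basis -/

/-! Everything is read off one model. `L` acts on polynomials in a, b, c, z, w by left
multiplication in normal order: a, c, z multiply by a variable, b acts as b − c∂_a and w as w −
(c³/3)∂_z. Applying an element to 1 gives its symbol, and `toPoly` is a linear isomorphism (PBW).
Right multiplications have a similar shape, so the inner derivations of a, b, z, w become c∂_b,
−c∂_a, (c³/3)∂_w, −(c³/3)∂_z. In characteristic 0 an element killed by all four involves only c,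
which gives the centre. The Ore tower and the growth estimates also come from the basis.

For the coalgebra, contract the first leg of Δ with the linear coefficient at a, b or c. On symbols
this gives the vector fields V_a = ∂_a + c∂_z, V_b = ∂_b + c∂_w, V_c = ∂_c − a∂_z − b∂_w, with [V_c,
V_a] = 2∂_z and [V_c, V_b] = 2∂_w. For the weights 1, 1, 1, 2, 2 each field lowers weight by one,
and together they detect weight (`mem_below_of_field`). Hence repeated contraction leads from any
nonzero element of a subcoalgebra to a nonzero scalar in it, so `L` is connected, and the coradical
filtration is the weight filtration (`coradicalFiltration_eq`). Both nontrivial commutators drop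
weight, so the associated graded algebra is polynomial. The connected grading uses other degrees, 1,
1, 2, 3, 3, for which the relations and the coproduct are homogeneous.

`L` is not an enveloping algebra for the following reason. Commutators are divisible by c, and the
quotients reduce modulo c to the Poisson bracket ∂_a ∧ ∂_b. Therefore the linear part in a, b, c is
a Lie homomorphism `linPart` from `L` to itself. If `L` were U(𝔫), its restriction to 𝔫 would extend
to an algebra endomorphism Φ whose image lies in the algebra generated by a, b, c. Then Φ(c) = c·y₀
with y₀ nonzero modulo c, while Φ(z) and Φ(w) commute with z, w, Φ(a), Φ(b) and are therefore scalar
modulo c², up to a scalar multiple of c. So [Φ(z), Φ(w)] is divisible by c⁴, whereas it equals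
c³y₀³/3, a contradiction (`not_forall_eq_linPart`). -/

/-- The polynomial algebra on which `L` acts; the variables `0, …, 4` stand for `a, b, c, z, w`. -/
abbrev Poly : Type u := MvPolynomial (Fin 5) k

variable {k}

/-- The operator of multiplication by a polynomial. -/
abbrev mulOp (p : Poly k) : Module.End k (Poly k) := LinearMap.mulLeft k p

/-- The partial derivative as an operator. -/
abbrev dOp (i : Fin 5) : Module.End k (Poly k) := (pderiv i).toLinearMap

/-- The operators by which the generators act from the left on normally ordered polynomials. -/
def leftOp : Gen → Module.End k (Poly k)
  | .a => mulOp (X 0)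
  | .b => mulOp (X 1) - mulOp (X 2) * dOp 0
  | .c => mulOp (X 2)
  | .z => mulOp (X 3)
  | .w => mulOp (X 4) - (3 : k)⁻¹ • (mulOp (X 2 ^ 3) * dOp 3)

/-- The operators by which the generators act from the right on normally ordered polynomials. -/
def rightOp : Gen → Module.End k (Poly k)
  | .a => mulOp (X 0) - mulOp (X 2) * dOp 1
  | .b => mulOp (X 1)
  | .c => mulOp (X 2)
  | .z => mulOp (X 3) - (3 : k)⁻¹ • (mulOp (X 2 ^ 3) * dOp 4)
  | .w => mulOp (X 4)

/-- The variable corresponding to a generator. -/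
def idx : Gen → Fin 5
  | .a => 0
  | .b => 1
  | .c => 2
  | .z => 3
  | .w => 4

@[simp] theorem leftOp_a (p : Poly k) : leftOp .a p = X 0 * p := rfl
@[simp] theorem leftOp_b (p : Poly k) : leftOp .b p = X 1 * p - X 2 * pderiv 0 p := rfl
@[simp] theorem leftOp_c (p : Poly k) : leftOp .c p = X 2 * p := rfl
@[simp] theorem leftOp_z (p : Poly k) : leftOp .z p = X 3 * p := rfl
@[simp] theorem leftOp_w (p : Poly k) :
    leftOp .w p = X 4 * p - C (3 : k)⁻¹ * (X 2 ^ 3 * pderiv 3 p) := by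
  rw [← smul_eq_C_mul]; rfl
@[simp] theorem rightOp_a (p : Poly k) : rightOp .a p = X 0 * p - X 2 * pderiv 1 p := rfl
@[simp] theorem rightOp_b (p : Poly k) : rightOp .b p = X 1 * p := rfl
@[simp] theorem rightOp_c (p : Poly k) : rightOp .c p = X 2 * p := rfl
@[simp] theorem rightOp_z (p : Poly k) :
    rightOp .z p = X 3 * p - C (3 : k)⁻¹ * (X 2 ^ 3 * pderiv 4 p) := by
  rw [← smul_eq_C_mul]; rfl
@[simp] theorem rightOp_w (p : Poly k) : rightOp .w p = X 4 * p := rfl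

theorem pderiv_comm (i j : Fin 5) (p : Poly k) :
    pderiv i (pderiv j p) = pderiv j (pderiv i p) := by
  have h : ⁅(pderiv i : Derivation k (Poly k) (Poly k)), (pderiv j : Derivation k (Poly k) (Poly k))⁆ = 0 := by
    refine MvPolynomial.derivation_ext fun l => ?_
    rw [Derivation.commutator_apply]
    have h : ∀ i j l : Fin 5, pderiv i (pderiv j (X l : Poly k)) = 0 := fun i j l => by
      by_cases hjl : l = j
      · subst hjl; simp
      · rw [pderiv_X_of_ne hjl, map_zero]
    rw [h, h, sub_self, Derivation.zero_apply]
  have := congrArg (fun D => D p) h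
  simpa [Derivation.commutator_apply, sub_eq_zero] using this

/-- The left regular representation, on normally ordered polynomials. -/
def rep : L k →ₐ[k] Module.End k (Poly k) :=
  lift leftOp (by
    intro x y h
    cases h <;>
    · simp only [free, map_sub, map_mul, map_smul, map_pow, FreeAlgebra.lift_ι_apply]
      refine LinearMap.ext fun p => ?_
      simp [pderiv_X, Derivation.leibniz, smul_eq_C_mul, pow_succ,
        pderiv_comm 3 0]
      try ring)

@[simp]
theorem rep_gen (g : Gen) : rep (gen k g) = leftOp g := lift_gen _ _ g

/-- A form of associativity that needs checking only on pairs of generators. Since every symbol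
arises from 1 by the left action, it forces `rightOp g` to be right multiplication by `gen k g`. -/
theorem rep_comm_rightOp (g : Gen) (f : L k) (p : Poly k) :
    rep f (rightOp g p) = rightOp g (rep f p) := by
  induction f using L.induction generalizing p with
  | halg r => simp [Algebra.algebraMap_eq_smul_one]
  | hgen h =>
    rw [rep_gen]
    cases g <;> cases h <;>
    · simp [pderiv_X, Derivation.leibniz, pow_succ,
        pderiv_comm 1 0, pderiv_comm 3 1, pderiv_comm 4 0, pderiv_comm 4 3]
      try ring
  | hmul x y hx hy => simp [hx, hy]
  | hadd x y hx hy => simp [hx, hy]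

/-- The normally ordered monomial `aⁱ bʲ cˡ zᵐ wⁿ`. -/
def mono (i j l m n : ℕ) : L k := a k ^ i * (b k ^ j * (c k ^ l * (z k ^ m * w k ^ n)))

theorem b_mul_a_pow (i : ℕ) (f : L k) :
    b k * (a k ^ (i + 1) * f) = a k ^ (i + 1) * (b k * f) - (i + 1) • (a k ^ i * (c k * f)) := by
  induction i generalizing f with
  | zero => simp only [zero_add, pow_one, pow_zero, ← mul_assoc, ba]; noncomm_ring
  | succ i ih =>
    have h : b k * (a k ^ (i + 1 + 1) * f) = b k * (a k ^ (i + 1) * (a k * f)) := by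
      rw [pow_succ, mul_assoc]
    have h1 : b k * (a k * f) = a k * (b k * f) - c k * f := by
      simp only [← mul_assoc, ba]; noncomm_ring
    have h2 : c k * (a k * f) = a k * (c k * f) := by simp only [← mul_assoc, ca]
    rw [h, ih, h1, h2, mul_sub, ← mul_assoc (a k ^ (i + 1)) (a k), ← pow_succ,
      ← mul_assoc (a k ^ i) (a k), ← pow_succ]
    simp only [succ_nsmul]
    abel

theorem w_mul_z_pow (i : ℕ) (f : L k) :
    w k * (z k ^ (i + 1) * f) =
      z k ^ (i + 1) * (w k * f) - ((3 : k)⁻¹ * (i + 1)) • (c k ^ 3 * (z k ^ i * f)) := by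
  have hc : ∀ f : L k, c k ^ 3 * (z k * f) = z k * (c k ^ 3 * f) := fun f => by
    rw [← mul_assoc, ← mul_assoc, (show Commute (c k) (z k) from zc.symm).pow_left 3]
  have h1 : ∀ f : L k, w k * (z k * f) = z k * (w k * f) - (3 : k)⁻¹ • (c k ^ 3 * f) := fun f => by
    rw [← mul_assoc, wz, sub_mul, smul_mul_assoc, mul_assoc]
  induction i generalizing f with
  | zero => simp [h1]
  | succ i ih =>
    rw [pow_succ', mul_assoc, h1, ih, pow_succ' (z k) i, mul_assoc (z k) _ f, hc]
    rw [mul_sub, mul_smul_comm]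
    push_cast
    simp only [mul_assoc]
    module

/-- Moving b past a power of a, or w past a power of z, produces only extra powers of the central c,
so the product can be sorted again. -/
theorem gen_mul_mono_mem (g : Gen) (i j l m n : ℕ) :
    gen k g * mono i j l m n ∈
      Submodule.span k (Set.range fun e : ℕ × ℕ × ℕ × ℕ × ℕ =>
        (mono e.1 e.2.1 e.2.2.1 e.2.2.2.1 e.2.2.2.2 : L k)) := by
  have hm : ∀ i j l m n : ℕ, (mono i j l m n : L k) ∈
      Submodule.span k (Set.range fun e : ℕ × ℕ × ℕ × ℕ × ℕ =>
        (mono e.1 e.2.1 e.2.2.1 e.2.2.2.1 e.2.2.2.2 : L k)) :=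
    fun i j l m n => Submodule.subset_span ⟨(i, j, l, m, n), rfl⟩
  have pc : ∀ {g h : Gen}, gen k g * gen k h = gen k h * gen k g → ∀ (n : ℕ) (f : L k),
      gen k g * (gen k h ^ n * f) = gen k h ^ n * (gen k g * f) := fun {g h} e n f => by
    rw [← mul_assoc, ← mul_assoc, (show Commute (gen k g) (gen k h) from e).pow_right n]
  cases g
  · convert hm (i + 1) j l m n using 1
    simp [mono, pow_succ', mul_assoc]
  · have e1 : ∀ i, a k ^ i * (b k * (b k ^ j * (c k ^ l * (z k ^ m * w k ^ n)))) =
        mono i (j + 1) l m n := fun i => by simp [mono, pow_succ', mul_assoc]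
    cases i with
    | zero =>
      convert hm 0 (j + 1) l m n using 1
      simp [mono, pow_succ', mul_assoc]
    | succ i =>
      rw [mono, b_mul_a_pow, e1, pc cb, ← mul_assoc (c k), ← pow_succ']
      exact Submodule.sub_mem _ (hm _ _ _ _ _) (Submodule.smul_of_tower_mem _ _ (hm i j (l + 1) m n))
  · convert hm i j (l + 1) m n using 1
    rw [mono, pc ca, pc cb, ← mul_assoc (c k), ← pow_succ', mono]
  · convert hm i j l (m + 1) n using 1
    rw [mono, pc za, pc zb, pc zc, ← mul_assoc (z k), ← pow_succ', mono]
  · rw [mono, pc wa, pc wb, pc wc]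
    cases m with
    | zero =>
      convert hm i j l 0 (n + 1) using 1
      simp [mono, pow_succ']
    | succ m =>
      rw [w_mul_z_pow, ← pow_succ', mul_sub, mul_sub, mul_sub, mul_smul_comm, mul_smul_comm,
        mul_smul_comm, ← mul_assoc (c k ^ l) (c k ^ 3), ← pow_add]
      exact Submodule.sub_mem _ (hm i j l (m + 1) (n + 1)) (Submodule.smul_mem _ _ (hm i j (l + 3) m n))

/-- The span is stable under left multiplication by generators, hence a left ideal, and it contains
1. -/
theorem span_mono :
    Submodule.span k (Set.range fun e : ℕ × ℕ × ℕ × ℕ × ℕ =>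
        (mono e.1 e.2.1 e.2.2.1 e.2.2.2.1 e.2.2.2.2 : L k)) = ⊤ := by
  set S := Submodule.span k (Set.range fun e : ℕ × ℕ × ℕ × ℕ × ℕ =>
        (mono e.1 e.2.1 e.2.2.1 e.2.2.2.1 e.2.2.2.2 : L k))
  have key : ∀ f : L k, ∀ x ∈ S, f * x ∈ S := by
    intro f
    induction f using L.induction with
    | halg r => intro x hx; rw [← Algebra.smul_def]; exact S.smul_mem r hx
    | hgen g =>
      intro x hx
      induction hx using Submodule.span_induction with
      | mem x hx => obtain ⟨e, rfl⟩ := hx; exact gen_mul_mono_mem g _ _ _ _ _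
      | zero => simp
      | add x y _ _ hx hy => rw [mul_add]; exact S.add_mem hx hy
      | smul r x _ hx => rw [mul_smul_comm]; exact S.smul_mem r hx
    | hmul x y hx hy => intro t ht; rw [mul_assoc]; exact hx _ (hy _ ht)
    | hadd x y hx hy => intro t ht; rw [add_mul]; exact S.add_mem (hx _ ht) (hy _ ht)
  refine (Submodule.eq_top_iff').2 fun f => ?_
  simpa using key f 1 (Submodule.subset_span ⟨(0, 0, 0, 0, 0), by simp [mono]⟩)

/-- The exponent vector of a normally ordered monomial. -/
def expo (i j l m n : ℕ) : Fin 5 →₀ ℕ := Finsupp.equivFunOnFinite.symm ![i, j, l, m, n]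

theorem monomial_expo (i j l m n : ℕ) : (monomial (expo i j l m n) (1 : k)) =
    X 0 ^ i * (X 1 ^ j * (X 2 ^ l * (X 3 ^ m * X 4 ^ n))) := by
  rw [monomial_eq, Finsupp.prod_fintype _ _ (by simp)]
  simp [Fin.prod_univ_succ, expo]

theorem expo_eq (e : Fin 5 →₀ ℕ) : expo (e 0) (e 1) (e 2) (e 3) (e 4) = e := by
  ext i; fin_cases i <;> rfl

/-- Factors act from the right end: no z is present when the w's act and no a when the b's act, so
the correction terms vanish. This is the linear independence half of PBW. -/
theorem rep_mono_one (i j l m n : ℕ) :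
    rep (mono i j l m n) (1 : Poly k) = monomial (expo i j l m n) 1 := by
  have ha : ∀ (i : ℕ) (p : Poly k), (leftOp .a ^ i) p = X 0 ^ i * p := fun i p => by
    induction i generalizing p with
    | zero => simp
    | succ i ih => simp [pow_succ, ih]; ring
  have hb : ∀ (i : ℕ) (p : Poly k), pderiv 0 p = 0 → (leftOp .b ^ i) p = X 1 ^ i * p := fun i p => by
    induction i generalizing p with
    | zero => simp
    | succ i ih =>
      intro hp
      rw [pow_succ, Module.End.mul_apply, leftOp_b, hp, ih _ (by simp [hp, pderiv_X])]
      ring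
  have hc : ∀ (i : ℕ) (p : Poly k), (leftOp .c ^ i) p = X 2 ^ i * p := fun i p => by
    induction i generalizing p with
    | zero => simp
    | succ i ih => simp [pow_succ, ih]; ring
  have hz : ∀ (i : ℕ) (p : Poly k), (leftOp .z ^ i) p = X 3 ^ i * p := fun i p => by
    induction i generalizing p with
    | zero => simp
    | succ i ih => simp [pow_succ, ih]; ring
  have hw : ∀ (i : ℕ) (p : Poly k), pderiv 3 p = 0 → (leftOp .w ^ i) p = X 4 ^ i * p := fun i p => by
    induction i generalizing p with
    | zero => simp
    | succ i ih =>
      intro hp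
      rw [pow_succ, Module.End.mul_apply, leftOp_w, hp, ih _ (by simp [hp, pderiv_X])]
      ring
  simp only [mono, map_mul, map_pow, rep_gen, Module.End.mul_apply]
  rw [hw _ _ (by simp), hz, hc, hb _ _ (by simp [pderiv_X, Derivation.leibniz_pow]), ha,
    monomial_expo, mul_one]

/-- The normally ordered symbol of an element of `L`. -/
def toPolyLin : L k →ₗ[k] Poly k := LinearMap.applyₗ (1 : Poly k) ∘ₗ rep.toLinearMap

/-- The normally ordered element with a given symbol. -/
def ofPolyLin : Poly k →ₗ[k] L k :=
  (basisMonomials (Fin 5) k).constr k fun e => mono (e 0) (e 1) (e 2) (e 3) (e 4)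

theorem ofPolyLin_monomial (e : Fin 5 →₀ ℕ) :
    ofPolyLin (monomial e (1 : k)) = mono (e 0) (e 1) (e 2) (e 3) (e 4) := by
  exact (basisMonomials (Fin 5) k).constr_basis k _ e

/-- The Poincaré–Birkhoff–Witt isomorphism: normally ordered monomials form a basis of `L`. -/
def toPoly : L k ≃ₗ[k] Poly k :=
  LinearEquiv.ofLinearMap toPolyLin ofPolyLin
    ((basisMonomials (Fin 5) k).ext fun e => by
      rw [coe_basisMonomials, LinearMap.comp_apply, ofPolyLin_monomial]
      exact (rep_mono_one _ _ _ _ _).trans (by rw [expo_eq]; rfl))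
    (by
      refine LinearMap.ext_on_range span_mono fun e => ?_
      have h : toPolyLin (mono e.1 e.2.1 e.2.2.1 e.2.2.2.1 e.2.2.2.2 : L k) = _ :=
        rep_mono_one _ _ _ _ _
      rw [LinearMap.comp_apply, h, ofPolyLin_monomial]
      rfl)

theorem toPoly_apply (f : L k) : toPoly f = rep f 1 := rfl

@[simp] theorem toPoly_one : toPoly (1 : L k) = 1 := by simp [toPoly_apply]

@[simp] theorem toPoly_algebraMap (r : k) : toPoly (algebraMap k (L k) r) = C r := by
  rw [Algebra.algebraMap_eq_smul_one, map_smul, toPoly_one, smul_eq_C_mul, mul_one]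

theorem toPoly_mul (f g : L k) : toPoly (f * g) = rep f (toPoly g) := by simp [toPoly_apply]

theorem toPoly_gen_mul (g : Gen) (f : L k) : toPoly (gen k g * f) = leftOp g (toPoly f) := by
  simp [toPoly_mul]

@[simp] theorem toPoly_gen (g : Gen) : toPoly (gen k g) = X (idx g) := by
  rw [toPoly_apply, rep_gen]; cases g <;> simp [idx]

theorem toPoly_mul_gen (g : Gen) (f : L k) : toPoly (f * gen k g) = rightOp g (toPoly f) := by
  have h : toPoly (gen k g) = rightOp g 1 := by rw [toPoly_gen]; cases g <;> simp [idx]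
  rw [toPoly_mul, h, rep_comm_rightOp, toPoly_apply]

theorem toPoly_symm_monomial (e : Fin 5 →₀ ℕ) :
    toPoly.symm (monomial e (1 : k)) = mono (e 0) (e 1) (e 2) (e 3) (e 4) :=
  ofPolyLin_monomial e

theorem toPoly_c_mul (f : L k) : toPoly (c k * f) = X 2 * toPoly f := toPoly_gen_mul .c f

theorem c_mul_comm (f : L k) : c k * f = f * c k :=
  toPoly.injective (by rw [toPoly_c_mul]; exact (toPoly_mul_gen .c f).symm)

theorem c_mul_left_cancel {f g : L k} (h : c k * f = c k * g) : f = g := by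
  have := congrArg toPoly h
  rw [toPoly_c_mul, toPoly_c_mul] at this
  exact toPoly.injective (mul_left_cancel₀ (X_ne_zero 2) this)

/-- The multiplication terms cancel between `leftOp` and `rightOp`, leaving one partial derivative.
This and its three analogues turn commutation hypotheses into vanishing derivatives. -/
theorem toPoly_a_comm (f : L k) :
    toPoly (a k * f - f * a k) = X 2 * pderiv 1 (toPoly f) := by
  rw [map_sub, toPoly_gen_mul, toPoly_mul_gen]; simp

theorem toPoly_b_comm (f : L k) :
    toPoly (b k * f - f * b k) = -(X 2 * pderiv 0 (toPoly f)) := by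
  rw [map_sub, toPoly_gen_mul, toPoly_mul_gen]; simp

theorem toPoly_z_comm (f : L k) :
    toPoly (z k * f - f * z k) = C (3 : k)⁻¹ * (X 2 ^ 3 * pderiv 4 (toPoly f)) := by
  rw [map_sub, toPoly_gen_mul, toPoly_mul_gen]; simp

theorem toPoly_w_comm (f : L k) :
    toPoly (w k * f - f * w k) = -(C (3 : k)⁻¹ * (X 2 ^ 3 * pderiv 3 (toPoly f))) := by
  rw [map_sub, toPoly_gen_mul, toPoly_mul_gen]; simp

end L

end ConnectedHopf

namespace ConnectedHopf

namespace L

open MvPolynomial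

variable {k : Type u} [Field k]

/-! ### The centre -/

/-- Characteristic zero enters here: differentiation multiplies the coefficient by the nonzero
integer `e i`. -/
theorem coeff_eq_zero_of_pderiv_eq_zero [CharZero k] {p : Poly k} {i : Fin 5} (h : pderiv i p = 0)
    {e : Fin 5 →₀ ℕ} (he : e i ≠ 0) : coeff e p = 0 := by
  have h1 := coeff_pderiv (i := i) p (e - Finsupp.single i 1)
  rw [h, coeff_zero, tsub_add_cancel_of_le
    (Finsupp.single_le_iff.2 (Nat.one_le_iff_ne_zero.2 he))] at h1
  exact (mul_eq_zero.1 h1.symm).resolve_right (Nat.cast_add_one_ne_zero _)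

theorem eq_sum_mono (f : L k) :
    f = ∑ e ∈ (toPoly f).support, coeff e (toPoly f) • mono (e 0) (e 1) (e 2) (e 3) (e 4) := by
  refine toPoly.injective ?_
  rw [map_sum]
  conv_lhs => rw [(toPoly f).as_sum]
  refine Finset.sum_congr rfl fun e _ => ?_
  rw [map_smul, ← toPoly_symm_monomial, LinearEquiv.apply_symm_apply, smul_monomial]
  simp

theorem pderiv_toPoly_of_commute_a {f : L k} (h : Commute (a k) f) : pderiv 1 (toPoly f) = 0 := by
  have := toPoly_a_comm f
  rw [h.eq, sub_self, map_zero] at this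
  exact (mul_eq_zero.1 this.symm).resolve_left (X_ne_zero _)

theorem pderiv_toPoly_of_commute_b {f : L k} (h : Commute (b k) f) : pderiv 0 (toPoly f) = 0 := by
  have := toPoly_b_comm f
  rw [h.eq, sub_self, map_zero] at this
  exact (mul_eq_zero.1 (neg_eq_zero.1 this.symm)).resolve_left (X_ne_zero _)

theorem pderiv_toPoly_of_commute_z [CharZero k] {f : L k} (h : Commute (z k) f) :
    pderiv 4 (toPoly f) = 0 := by
  have := toPoly_z_comm f
  rw [h.eq, sub_self, map_zero] at this
  simpa using this.symm

theorem pderiv_toPoly_of_commute_w [CharZero k] {f : L k} (h : Commute (w k) f) :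
    pderiv 3 (toPoly f) = 0 := by
  have := toPoly_w_comm f
  rw [h.eq, sub_self, map_zero] at this
  simpa using this.symm

/-- Commuting with b, a, w, z removes the variables a, b, z, w respectively, so only powers of c
remain. -/
theorem center_eq [CharZero k] : Subalgebra.center k (L k) = Algebra.adjoin k {c k} := by
  apply le_antisymm
  · intro f hf
    rw [Subalgebra.mem_center_iff] at hf
    rw [eq_sum_mono f]
    refine Subalgebra.sum_mem _ fun e he => Subalgebra.smul_mem _ ?_ _
    rw [mem_support_iff] at he
    have h0 : e 0 = 0 := by
      by_contra h
      exact he (coeff_eq_zero_of_pderiv_eq_zero (pderiv_toPoly_of_commute_b (hf _)) h)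
    have h1 : e 1 = 0 := by
      by_contra h
      exact he (coeff_eq_zero_of_pderiv_eq_zero (pderiv_toPoly_of_commute_a (hf _)) h)
    have h3 : e 3 = 0 := by
      by_contra h
      exact he (coeff_eq_zero_of_pderiv_eq_zero (pderiv_toPoly_of_commute_w (hf _)) h)
    have h4 : e 4 = 0 := by
      by_contra h
      exact he (coeff_eq_zero_of_pderiv_eq_zero (pderiv_toPoly_of_commute_z (hf _)) h)
    simp only [mono, h0, h1, h3, h4, pow_zero, one_mul, mul_one]
    exact Subalgebra.pow_mem _ (Algebra.self_mem_adjoin_singleton k _) _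
  · rw [Algebra.adjoin_le_iff, Set.singleton_subset_iff, SetLike.mem_coe,
      Subalgebra.mem_center_iff]
    exact fun f => (c_mul_comm f).symm

theorem transcendental_c : Transcendental k (c k) := by
  rw [transcendental_iff]
  intro p hp
  have key : toPoly (Polynomial.aeval (c k) p) = Polynomial.aeval (X 2 : Poly k) p := by
    have hpow : ∀ n : ℕ, toPoly (c k ^ n) = X 2 ^ n := fun n => by
      induction n with
      | zero => simp
      | succ n ih => rw [pow_succ', pow_succ', toPoly_c_mul, ih]
    rw [Polynomial.aeval_eq_sum_range, Polynomial.aeval_eq_sum_range, map_sum]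
    simp [hpow]
  rw [hp, map_zero] at key
  exact (transcendental_iff.1 (transcendental_X k (2 : Fin 5))) p key.symm

/-! ### Contractions of the coproduct -/

/-- The constant coefficient, as a linear functional. -/
def constCoeff : Poly k →ₗ[k] k where
  toFun := constantCoeff
  map_add' := map_add _
  map_smul' r p := by simp [smul_eq_C_mul]

/-- The linear coefficient of the `i`-th variable in the normally ordered symbol. -/
def linCoeff (i : Fin 5) : L k →ₗ[k] k := constCoeff ∘ₗ (pderiv i).toLinearMap ∘ₗ toPoly.toLinearMap

theorem linCoeff_apply (i : Fin 5) (f : L k) : linCoeff i f = constantCoeff (pderiv i (toPoly f)) :=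
  rfl

theorem linCoeff_one (i : Fin 5) : linCoeff i (1 : L k) = 0 := by simp [linCoeff_apply]

/-- `ξ ⊗ id`, as a map to `L`. -/
def contract (ξ : L k →ₗ[k] k) : L k ⊗[k] L k →ₗ[k] L k :=
  (TensorProduct.lid k (L k)).toLinearMap ∘ₗ ξ.rTensor (L k)

@[simp] theorem contract_tmul (ξ : L k →ₗ[k] k) (x y : L k) : contract ξ (x ⊗ₜ[k] y) = ξ x • y := by
  simp [contract]

theorem contract_neg (ξ : L k →ₗ[k] k) (t : L k ⊗[k] L k) : contract (-ξ) t = -contract ξ t := by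
  simp [contract, LinearMap.rTensor_neg]

theorem contract_zero (t : L k ⊗[k] L k) : contract (0 : L k →ₗ[k] k) t = 0 := by
  simp [contract]

/-- Allows the coproduct of a product to be contracted one factor at a time: the first leg is
absorbed into the functional, the second is pulled out. -/
theorem contract_tmul_mul (ξ : L k →ₗ[k] k) (x y : L k) (t : L k ⊗[k] L k) :
    contract ξ (x ⊗ₜ[k] y * t) = y * contract (ξ ∘ₗ LinearMap.mulLeft k x) t := by
  induction t with
  | zero => simp
  | add t t' h h' => simp only [mul_add, map_add, h, h']
  | tmul u v => simp

/-- Normal ordering rewrites ba as ab − c, so `linCoeff 2` is not a point derivation at the counit.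
This is the only exceptional case. -/
theorem linCoeff_comp_mulLeft_b :
    linCoeff 2 ∘ₗ LinearMap.mulLeft k (b k) = -linCoeff 0 := by
  ext f
  simp only [LinearMap.comp_apply, LinearMap.mulLeft_apply, linCoeff_apply, toPoly_gen_mul]
  simp [pderiv_X, linCoeff_apply]

variable [CharZero k]

theorem counit_eq (f : L k) : Coalgebra.counit (R := k) f = constantCoeff (toPoly f) := by
  -- Strengthened to the action on every p so that the induction passes through products; the
  -- correction terms carry a factor c and vanish at the origin.
  suffices h : ∀ p : Poly k, constantCoeff (rep f p) = Coalgebra.counit (R := k) f *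
      constantCoeff p by simpa [toPoly_apply] using (h 1).symm
  induction f using L.induction with
  | halg r => intro p; simp [Algebra.algebraMap_eq_smul_one, smul_eq_C_mul]
  | hgen g => intro p; rw [rep_gen]; cases g <;> simp
  | hmul x y hx hy => intro p; simp [hx, hy, mul_assoc]
  | hadd x y hx hy => intro p; simp [hx, hy, add_mul]

theorem contract_counit_comul (f : L k) :
    contract (Coalgebra.counit (R := k)) (Coalgebra.comul (R := k) f) = f := by
  simp [contract]

/-- The coefficient of degree one in the first tensor factor of the coproduct. -/
def coDeriv (i : Fin 5) (f : L k) : L k := contract (linCoeff i) (Coalgebra.comul (R := k) f)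

/-- The product rule for `linCoeff`. -/
theorem linCoeff_comp_mulLeft (i : Fin 5) (g : Gen) (h2 : i ≠ 2 ∨ g ≠ .b) :
    linCoeff i ∘ₗ LinearMap.mulLeft k (gen k g) =
      if idx g = i then Coalgebra.counit (R := k) else 0 := by
  ext f
  simp only [LinearMap.comp_apply, LinearMap.mulLeft_apply, linCoeff_apply, toPoly_gen_mul]
  cases g <;> fin_cases i <;> simp_all [idx, pderiv_X, counit_eq]

/-- The vector fields `∂a + c ∂z`, `∂b + c ∂w`, `∂c - a ∂z - b ∂w`. -/
def field : Fin 3 → Derivation k (Poly k) (Poly k)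
  | 0 => pderiv 0 + (X 2 : Poly k) • pderiv 3
  | 1 => pderiv 1 + (X 2 : Poly k) • pderiv 4
  | 2 => pderiv 2 - (X 0 : Poly k) • pderiv 3 - (X 1 : Poly k) • pderiv 4


theorem coDeriv_one (i : Fin 5) : coDeriv i (1 : L k) = 0 := by
  simp [coDeriv, Algebra.TensorProduct.one_def, linCoeff_one]

theorem coDeriv_add (i : Fin 5) (f g : L k) : coDeriv i (f + g) = coDeriv i f + coDeriv i g := by
  simp [coDeriv]

theorem coDeriv_smul (i : Fin 5) (r : k) (f : L k) : coDeriv i (r • f) = r • coDeriv i f := by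
  simp [coDeriv]

/-- To identify `coDeriv i` with a derivation of polynomials, it suffices to compare the behaviour
under left multiplication by generators. -/
theorem toPoly_coDeriv_of_gen_mul (i : Fin 5) (V : Derivation k (Poly k) (Poly k))
    (h : ∀ (g : Gen) (f : L k), toPoly (coDeriv i f) = V (toPoly f) →
      toPoly (coDeriv i (gen k g * f)) = V (toPoly (gen k g * f))) (f : L k) :
    toPoly (coDeriv i f) = V (toPoly f) := by
  suffices H : ∀ f g : L k, toPoly (coDeriv i g) = V (toPoly g) →
      toPoly (coDeriv i (f * g)) = V (toPoly (f * g)) by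
    simpa using H f 1 (by simp [coDeriv_one])
  intro f
  induction f using L.induction with
  | halg r =>
    intro g hg
    rw [← Algebra.smul_def, coDeriv_smul, map_smul, map_smul, hg, Derivation.map_smul]
  | hgen g => exact fun f => h g f
  | hmul x y hx hy => intro g hg; rw [mul_assoc]; exact hx _ (hy _ hg)
  | hadd x y hx hy =>
    intro g hg
    rw [add_mul, coDeriv_add, map_add, hx g hg, hy g hg, map_add, map_add]

theorem toPoly_coDeriv_zero (f : L k) : toPoly (coDeriv 0 f) = field 0 (toPoly f) := by
  refine toPoly_coDeriv_of_gen_mul 0 _ (fun g f hf => ?_) f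
  simp only [coDeriv, Bialgebra.comul_mul, comul_gen] at hf ⊢
  cases g <;>
  · simp [comulGen, add_mul, sub_mul, contract_tmul_mul,
      linCoeff_comp_mulLeft 0 _ (Or.inl (by decide)), idx, contract_counit_comul, contract_zero,
      toPoly_gen_mul, hf]
    simp [field, pderiv_X, Derivation.leibniz, pderiv_comm 3 0, pow_succ]
    try ring

theorem toPoly_coDeriv_one (f : L k) : toPoly (coDeriv 1 f) = field 1 (toPoly f) := by
  refine toPoly_coDeriv_of_gen_mul 1 _ (fun g f hf => ?_) f
  simp only [coDeriv, Bialgebra.comul_mul, comul_gen] at hf ⊢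
  cases g <;>
  · simp [comulGen, add_mul, sub_mul, contract_tmul_mul,
      linCoeff_comp_mulLeft 1 _ (Or.inl (by decide)), idx, contract_counit_comul, contract_zero,
      toPoly_gen_mul, hf]
    simp [field, pderiv_X, Derivation.leibniz, pderiv_comm 1 0, pderiv_comm 4 0, pderiv_comm 4 3,
      pderiv_comm 3 1, pow_succ]
    try ring

/-- The exceptional rule `linCoeff_comp_mulLeft_b` brings in `coDeriv 0`. For w this leaves −c²∂_z,
which is exactly what ∂_c makes of the normal-ordering term −(c³/3)∂_z; the coefficient 1/3 is
needed here. -/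
theorem toPoly_coDeriv_two (f : L k) : toPoly (coDeriv 2 f) = field 2 (toPoly f) := by
  refine toPoly_coDeriv_of_gen_mul 2 _ (fun g f hf => ?_) f
  have h0 := toPoly_coDeriv_zero f
  have h3 : C (3 : k)⁻¹ * 3 = (1 : Poly k) := by
    rw [← map_ofNat (C : k →+* Poly k) 3, ← C_mul, inv_mul_cancel₀ (by norm_num), C_1]
  simp only [coDeriv, Bialgebra.comul_mul, comul_gen] at hf h0 ⊢
  cases g <;>
  · simp [comulGen, add_mul, sub_mul, contract_tmul_mul, linCoeff_comp_mulLeft_b,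
      linCoeff_comp_mulLeft 2 Gen.a (Or.inr (by simp)),
      linCoeff_comp_mulLeft 2 Gen.c (Or.inr (by simp)),
      linCoeff_comp_mulLeft 2 Gen.z (Or.inr (by simp)),
      linCoeff_comp_mulLeft 2 Gen.w (Or.inr (by simp)), idx, contract_counit_comul, contract_zero,
      contract_neg, toPoly_gen_mul, hf, h0]
    simp [field, pderiv_X, Derivation.leibniz, pderiv_comm 2 0, pderiv_comm 4 0, pderiv_comm 4 3,
      pderiv_comm 3 0, pderiv_comm 3 2, pow_succ]
    try first
      | ring1
      | linear_combination (X 2 ^ 2 * pderiv 3 (toPoly f)) * h3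

/-- The embedding of the indices of the primitive generators. -/
def primIdx : Fin 3 → Fin 5 := ![0, 1, 2]

theorem toPoly_coDeriv (i : Fin 3) (f : L k) :
    toPoly (coDeriv (primIdx i) f) = field i (toPoly f) := by
  fin_cases i
  exacts [toPoly_coDeriv_zero f, toPoly_coDeriv_one f, toPoly_coDeriv_two f]

end L

end ConnectedHopf

namespace ConnectedHopf

namespace L

open MvPolynomial

variable {k : Type u} [Field k]

/-! ### The weight filtration -/

/-- The weights of `a, b, c, z, w` for the coradical filtration. -/
def wt : Fin 5 → ℕ := ![1, 1, 1, 2, 2]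

variable (k) in
/-- Polynomials all of whose monomials have weight less than `n`. -/
def below (n : ℕ) : Submodule k (Poly k) := restrictSupport k {e | Finsupp.weight wt e < n}

theorem mem_below {n : ℕ} {p : Poly k} :
    p ∈ below k n ↔ ∀ e, coeff e p ≠ 0 → Finsupp.weight wt e < n := by
  simp [below, mem_restrictSupport_iff, Set.subset_def]

theorem below_mono {m n : ℕ} (h : m ≤ n) : below k m ≤ below k n :=
  restrictSupport_mono k fun _ he => lt_of_lt_of_le he h

theorem below_zero : below k 0 = ⊥ := by
  rw [eq_bot_iff]
  intro p hp
  rw [mem_below] at hp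
  rw [Submodule.mem_bot]
  ext e
  by_contra h
  exact absurd (hp e h) (Nat.not_lt_zero _)

theorem mul_mem_below {m n : ℕ} {p q : Poly k} (hp : p ∈ below k (m + 1)) (hq : q ∈ below k (n + 1)) :
    p * q ∈ below k (m + n + 1) := by
  classical
  rw [mem_below] at *
  intro e he
  rw [coeff_mul] at he
  obtain ⟨⟨d, d'⟩, hd, hne⟩ := Finset.exists_ne_zero_of_sum_ne_zero he
  rw [Finset.HasAntidiagonal.mem_antidiagonal] at hd
  change d + d' = e at hd
  have h1 := hp d (left_ne_zero_of_mul hne)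
  have h2 := hq d' (right_ne_zero_of_mul hne)
  rw [← hd, map_add]
  omega

theorem monomial_mem_below (e : Fin 5 →₀ ℕ) (r : k) :
    monomial e r ∈ below k (Finsupp.weight wt e + 1) := by
  classical
  rw [mem_below]
  intro d hd
  rw [coeff_monomial] at hd
  split_ifs at hd with h
  · subst h; omega
  · exact absurd rfl hd

theorem X_mem_below (i : Fin 5) : (X i : Poly k) ∈ below k (wt i + 1) := by
  have := monomial_mem_below (k := k) (Finsupp.single i 1) 1
  rwa [Finsupp.weight_single, one_smul] at this

theorem one_mem_below : (1 : Poly k) ∈ below k 1 := by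
  simpa using monomial_mem_below (k := k) 0 1

theorem mul_mem_below_of_mem {m n : ℕ} {p q : Poly k} (hp : p ∈ below k (m + 1)) (hq : q ∈ below k n) :
    p * q ∈ below k (m + n) := by
  cases n with
  | zero =>
    rw [below_zero, Submodule.mem_bot] at hq
    simp [hq]
  | succ n => exact mul_mem_below hp hq

theorem X_mul_mem_below (i : Fin 5) {n : ℕ} {q : Poly k} (hq : q ∈ below k n) :
    X i * q ∈ below k (wt i + n) :=
  mul_mem_below_of_mem (X_mem_below i) hq

theorem pderiv_mem_below (i : Fin 5) {m n : ℕ} {p : Poly k} (hp : p ∈ below k m)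
    (h : m ≤ n + wt i) : pderiv i p ∈ below k n := by
  rw [mem_below] at *
  intro e he
  rw [coeff_pderiv] at he
  have := hp _ (left_ne_zero_of_mul he)
  rw [map_add, Finsupp.weight_single, one_smul] at this
  omega

theorem X_mul_mem_below_of_pred (i : Fin 5) (hi : wt i = 1) {n : ℕ} {q : Poly k}
    (hq : q ∈ below k (n - 1)) : X i * q ∈ below k n := by
  cases n with
  | zero =>
    have : q = 0 := by simpa [below_zero] using hq
    simp [this]
  | succ n =>
    have := X_mul_mem_below i hq
    rw [hi] at this
    exact below_mono (by omega) this

/-- Each field is homogeneous of weight −1. For n = 1 the bound says that the fields kill constants.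
-/
theorem field_mem_below (i : Fin 3) {n : ℕ} {p : Poly k} (hp : p ∈ below k n) :
    field i p ∈ below k (n - 1) := by
  have h1 : ∀ j : Fin 5, wt j = 1 → pderiv j p ∈ below k (n - 1) := fun j hj =>
    pderiv_mem_below j hp (by omega)
  have h2 : ∀ j l : Fin 5, wt j = 2 → wt l = 1 → X l * pderiv j p ∈ below k (n - 1) :=
    fun j l hj hl => X_mul_mem_below_of_pred l hl (pderiv_mem_below j hp (by omega))
  fin_cases i
  · exact Submodule.add_mem _ (h1 0 rfl) (h2 3 2 rfl rfl)
  · exact Submodule.add_mem _ (h1 1 rfl) (h2 4 2 rfl rfl)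
  · exact Submodule.sub_mem _ (Submodule.sub_mem _ (h1 2 rfl) (h2 3 0 rfl rfl)) (h2 4 1 rfl rfl)

theorem exists_mem_below (p : Poly k) : ∃ n, p ∈ below k n := by
  induction p using MvPolynomial.induction_on' with
  | monomial e r => exact ⟨_, monomial_mem_below e r⟩
  | add p q hp hq =>
    obtain ⟨m, hm⟩ := hp
    obtain ⟨n, hn⟩ := hq
    exact ⟨max m n, Submodule.add_mem _ (below_mono (le_max_left _ _) hm)
      (below_mono (le_max_right _ _) hn)⟩

theorem eq_C_of_mem_below_one {p : Poly k} (hp : p ∈ below k 1) : p = C (constantCoeff p) := by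
  classical
  ext e
  rw [coeff_C]
  split_ifs with h
  · rw [← h]; rfl
  · by_contra hne
    have h0 := mem_below.1 hp e hne
    have h1 : Finsupp.weight wt e = 0 := by omega
    have := Finsupp.nonTorsionWeight_of (R := ℕ) (w := wt) (by decide)
    rw [Finsupp.weight_eq_zero_iff_eq_zero] at h1
    exact h h1.symm

/-- Second legs stay in E. Hence subcoalgebras are stable under `coDeriv`, and the summand L ⊗ Lₙ in
the coradical filtration contracts into Lₙ. -/
theorem contract_mem {E : Submodule k (L k)} (ξ : L k →ₗ[k] k) {D : Submodule k (L k)}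
    {t : L k ⊗[k] L k} (ht : t ∈ tensorSub k D E) : contract ξ t ∈ E := by
  obtain ⟨s, rfl⟩ := ht
  induction s with
  | zero => simp
  | add s s' h h' => rw [map_add, map_add]; exact E.add_mem h h'
  | tmul x y => simpa using E.smul_mem _ y.2

variable [CharZero k]

/-- In characteristic zero a nonconstant monomial survives differentiation in any variable it
contains, and that derivative determines its weight. The constant term is free, since 0 < n + 1. -/
theorem mem_below_of_pderiv {n : ℕ} {p : Poly k}
    (h : ∀ i, pderiv i p ∈ below k (n + 1 - wt i)) : p ∈ below k (n + 1) := by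
  rw [mem_below]
  intro e he
  by_cases h0 : e = 0
  · simp [h0]
  · obtain ⟨i, hi⟩ := Finsupp.ne_iff.1 h0
    have hle : Finsupp.single i 1 ≤ e :=
      Finsupp.single_le_iff.2 (Nat.one_le_iff_ne_zero.2 (by simpa using hi))
    have h1 := (mem_below.1 (h i)) (e - Finsupp.single i 1) (by
      rw [coeff_pderiv, tsub_add_cancel_of_le hle]
      exact mul_ne_zero he (Nat.cast_add_one_ne_zero _))
    have h2 : Finsupp.weight wt (e - Finsupp.single i 1) + wt i = Finsupp.weight wt e := by
      conv_rhs => rw [← tsub_add_cancel_of_le hle, map_add, Finsupp.weight_single, one_smul]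
    omega

/-- The commutators of the three vector fields recover `∂z` and `∂w`; hence the weight of a
polynomial is determined by the weights of its images. -/
theorem mem_below_of_field {n : ℕ} {p : Poly k} (h : ∀ i, field i p ∈ below k n) :
    p ∈ below k (n + 1) := by
  have h3 : pderiv 3 p ∈ below k (n - 1) := by
    -- The identity [V_c, V_a] = 2∂_z; the second field applied lowers the bound from n to n − 1.
    have e : (2 : k) • pderiv 3 p = field 2 (field 0 p) - field 0 (field 2 p) := by
      simp [field, pderiv_X, Derivation.leibniz, pderiv_comm 4 0, pderiv_comm 4 3,
        pderiv_comm 3 0, pderiv_comm 3 2, pderiv_comm 2 0, smul_eq_C_mul, map_ofNat C]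
      ring
    rw [← Submodule.smul_mem_iff _ (two_ne_zero (α := k)), e]
    exact Submodule.sub_mem _ (field_mem_below 2 (h 0)) (field_mem_below 0 (h 2))
  have h4 : pderiv 4 p ∈ below k (n - 1) := by
    have e : (2 : k) • pderiv 4 p = field 2 (field 1 p) - field 1 (field 2 p) := by
      simp [field, pderiv_X, Derivation.leibniz, pderiv_comm 4 1, pderiv_comm 4 3,
        pderiv_comm 3 1, pderiv_comm 4 2, pderiv_comm 2 1, smul_eq_C_mul, map_ofNat C]
      ring
    rw [← Submodule.smul_mem_iff _ (two_ne_zero (α := k)), e]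
    exact Submodule.sub_mem _ (field_mem_below 2 (h 1)) (field_mem_below 1 (h 2))
  refine mem_below_of_pderiv fun i => ?_
  fin_cases i
  -- With ∂_z and ∂_w under control, their terms are removed from the fields to isolate ∂_a, ∂_b,
  -- ∂_c.
  · have := Submodule.sub_mem _ (h 0) (X_mul_mem_below_of_pred 2 rfl h3)
    change pderiv 0 p ∈ below k n
    simpa [field] using this
  · have := Submodule.sub_mem _ (h 1) (X_mul_mem_below_of_pred 2 rfl h4)
    change pderiv 1 p ∈ below k n
    simpa [field] using this
  · have := Submodule.add_mem _ (Submodule.add_mem _ (h 2) (X_mul_mem_below_of_pred 1 rfl h4))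
      (X_mul_mem_below_of_pred 0 rfl h3)
    change pderiv 2 p ∈ below k n
    simpa [field] using this
  · exact h3
  · exact h4

/-! ### Connectedness -/

/-- Contract a nonzero element repeatedly: every contraction stays in E and has a smaller weight
bound. When all three vanish, `mem_below_of_field` with n = 0 shows that the element is a nonzero
scalar. -/
theorem one_mem_of_isSubcoalgebra {E : Submodule k (L k)} (hE : IsSubcoalgebra k E) (h0 : E ≠ ⊥) :
    (1 : L k) ∈ E := by
  have key : ∀ n : ℕ, ∀ f ∈ E, f ≠ 0 → toPoly f ∈ below k n → (1 : L k) ∈ E := by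
    intro n
    induction n with
    | zero =>
      intro f _ hf h
      rw [below_zero, Submodule.mem_bot] at h
      exact absurd (toPoly.map_eq_zero_iff.1 h) hf
    | succ n ih =>
      intro f hfE hf h
      by_cases hall : ∀ i : Fin 3, field i (toPoly f) = 0
      · have h1 := eq_C_of_mem_below_one (mem_below_of_field (n := 0) (p := toPoly f)
          (fun i => by rw [hall i]; exact Submodule.zero_mem _))
        set r := constantCoeff (toPoly f)
        have hf' : f = r • (1 : L k) := toPoly.injective (by
          rw [h1, map_smul, toPoly_one, smul_eq_C_mul, mul_one])
        have hr : r ≠ 0 := fun hr => hf (by rw [hf', hr, zero_smul])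
        rw [hf'] at hfE
        exact (Submodule.smul_mem_iff _ hr).1 hfE
      · push Not at hall
        obtain ⟨i, hi⟩ := hall
        refine ih (coDeriv (primIdx i) f)
          (contract_mem _ (hE (Submodule.mem_map_of_mem hfE))) (fun h' => hi ?_) ?_
        · rw [← toPoly_coDeriv, h', map_zero]
        · rw [toPoly_coDeriv]
          exact field_mem_below i h
  obtain ⟨f, hfE, hf⟩ := Submodule.exists_mem_ne_zero_of_ne_bot h0
  obtain ⟨n, hn⟩ := exists_mem_below (toPoly f)
  exact key n f hfE hf hn

theorem isSubcoalgebra_one : IsSubcoalgebra k (1 : Submodule k (L k)) := by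
  rintro _ ⟨f, hf, rfl⟩
  obtain ⟨r, rfl⟩ := Submodule.mem_one.1 hf
  let e : (1 : Submodule k (L k)) := ⟨1, Submodule.mem_one.2 ⟨1, map_one _⟩⟩
  refine ⟨r • (e ⊗ₜ e), ?_⟩
  simp [e, Algebra.algebraMap_eq_smul_one, Algebra.TensorProduct.one_def]

/-- Every nonzero subcoalgebra contains the subcoalgebra k, so k is the only simple one. -/
theorem isConnected : IsConnected k (L k) := by
  have hne : (1 : Submodule k (L k)) ≠ ⊥ := fun h => by
    have : (1 : L k) ∈ (⊥ : Submodule k (L k)) := h ▸ (Submodule.mem_one.2 ⟨1, map_one _⟩)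
    rw [Submodule.mem_bot] at this
    have := congrArg toPoly this
    simp at this
  have hle : ∀ {E : Submodule k (L k)}, IsSubcoalgebra k E → E ≠ ⊥ → 1 ≤ E := fun hE h0 =>
    Submodule.one_le.2 (one_mem_of_isSubcoalgebra hE h0)
  refine le_antisymm (sSup_le ?_) (le_sSup ?_)
  · rintro D ⟨hD, h0, hs⟩
    exact ((hs 1 isSubcoalgebra_one (hle hD h0)).resolve_left hne).ge
  · exact ⟨isSubcoalgebra_one, hne, fun E hE hE1 => or_iff_not_imp_left.2 fun h0 =>
      le_antisymm hE1 (hle hE h0)⟩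

end L

end ConnectedHopf

namespace ConnectedHopf

/-! ### Filtrations and gradings on the tensor square -/

section TensorFiltration

variable {k : Type u} {A : Type v} [Field k] [Ring A] [Algebra k A]

theorem tensorSub_eq_span (D E : Submodule k A) :
    tensorSub k D E = Submodule.span k {t | ∃ x ∈ D, ∃ y ∈ E, x ⊗ₜ[k] y = t} := by
  apply le_antisymm
  · rintro _ ⟨s, rfl⟩
    induction s with
    | zero => simp
    | add s s' h h' => rw [map_add]; exact Submodule.add_mem _ h h'
    | tmul x y => exact Submodule.subset_span ⟨x, x.2, y, y.2, by simp⟩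
  · rw [Submodule.span_le]
    rintro _ ⟨x, hx, y, hy, rfl⟩
    exact ⟨⟨x, hx⟩ ⊗ₜ ⟨y, hy⟩, by simp⟩

theorem tmul_mem_tensorSub {D E : Submodule k A} {x y : A} (hx : x ∈ D) (hy : y ∈ E) :
    x ⊗ₜ[k] y ∈ tensorSub k D E :=
  ⟨⟨x, hx⟩ ⊗ₜ ⟨y, hy⟩, by simp⟩

theorem tensorSub_mono {D D' E E' : Submodule k A} (h : D ≤ D') (h' : E ≤ E') :
    tensorSub k D E ≤ tensorSub k D' E' := by
  rw [tensorSub_eq_span, tensorSub_eq_span]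
  refine Submodule.span_mono ?_
  rintro _ ⟨x, hx, y, hy, rfl⟩
  exact ⟨x, h hx, y, h' hy, rfl⟩

/-- The family of subspaces `∑ 𝓕 i ⊗ 𝓕 j`, over `i + j = m`, of `A ⊗ A`. -/
def tensorFil (𝓕 : ℕ → Submodule k A) (m : ℕ) : Submodule k (A ⊗[k] A) :=
  ⨆ (i : ℕ) (j : ℕ) (_ : i + j = m), tensorSub k (𝓕 i) (𝓕 j)

variable {𝓕 : ℕ → Submodule k A}

theorem tmul_mem_tensorFil {i j m : ℕ} (h : i + j = m) {x y : A} (hx : x ∈ 𝓕 i) (hy : y ∈ 𝓕 j) :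
    x ⊗ₜ[k] y ∈ tensorFil 𝓕 m :=
  (le_iSup_of_le i (le_iSup_of_le j (le_iSup_of_le h le_rfl)) :
    tensorSub k (𝓕 i) (𝓕 j) ≤ tensorFil 𝓕 m) (tmul_mem_tensorSub hx hy)

theorem tensorFil_eq_span (m : ℕ) : tensorFil 𝓕 m =
    Submodule.span k {t | ∃ i j, i + j = m ∧ ∃ x ∈ 𝓕 i, ∃ y ∈ 𝓕 j, x ⊗ₜ[k] y = t} := by
  apply le_antisymm
  · refine iSup_le fun i => iSup_le fun j => iSup_le fun h => ?_
    rw [tensorSub_eq_span]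
    refine Submodule.span_mono ?_
    rintro _ ⟨x, hx, y, hy, rfl⟩
    exact ⟨i, j, h, x, hx, y, hy, rfl⟩
  · rw [Submodule.span_le]
    rintro _ ⟨i, j, h, x, hx, y, hy, rfl⟩
    exact tmul_mem_tensorFil h hx hy

theorem tensorFil_mono (h : Monotone 𝓕) {m n : ℕ} (hmn : m ≤ n) :
    tensorFil 𝓕 m ≤ tensorFil 𝓕 n := by
  rw [tensorFil_eq_span, Submodule.span_le]
  rintro _ ⟨i, j, hij, x, hx, y, hy, rfl⟩
  -- The surplus n − m is put on the second factor.
  exact tmul_mem_tensorFil (i := i) (j := j + (n - m)) (by omega) hx (h (by omega) hy)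

theorem mul_mem_tensorFil (hmul : ∀ i j, ∀ x ∈ 𝓕 i, ∀ y ∈ 𝓕 j, x * y ∈ 𝓕 (i + j)) {m n : ℕ}
    {s t : A ⊗[k] A} (hs : s ∈ tensorFil 𝓕 m) (ht : t ∈ tensorFil 𝓕 n) :
    s * t ∈ tensorFil 𝓕 (m + n) := by
  rw [tensorFil_eq_span] at hs ht
  induction hs using Submodule.span_induction with
  | mem s hs =>
    obtain ⟨i, j, h, x, hx, y, hy, rfl⟩ := hs
    induction ht using Submodule.span_induction with
    | mem t ht =>
      obtain ⟨i', j', h', x', hx', y', hy', rfl⟩ := ht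
      rw [Algebra.TensorProduct.tmul_mul_tmul]
      exact tmul_mem_tensorFil (by omega) (hmul i i' x hx x' hx') (hmul j j' y hy y' hy')
    | zero => simp
    | add t t' _ _ h h' => rw [mul_add]; exact Submodule.add_mem _ h h'
    | smul r t _ h => rw [mul_smul_comm]; exact Submodule.smul_mem _ r h
  | zero => simp
  | add t t' _ _ h h' => rw [add_mul]; exact Submodule.add_mem _ h h'
  | smul r t _ h => rw [smul_mul_assoc]; exact Submodule.smul_mem _ r h

theorem pow_mem_of_graded {B : Type*} [Ring B] [Algebra k B] {𝓖 : ℕ → Submodule k B}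
    (h1 : (1 : B) ∈ 𝓖 0)
    (hmul : ∀ i j, ∀ x ∈ 𝓖 i, ∀ y ∈ 𝓖 j, x * y ∈ 𝓖 (i + j)) {d : ℕ} {x : B} (hx : x ∈ 𝓖 d)
    (n : ℕ) : x ^ n ∈ 𝓖 (n * d) := by
  induction n with
  | zero => simpa using h1
  | succ n ih =>
    rw [pow_succ, add_mul, one_mul]
    exact hmul _ _ _ ih _ hx

end TensorFiltration

namespace L

open MvPolynomial

variable {k : Type u} [Field k]

/-! ### Degrees of normally ordered monomials under algebra homomorphisms -/

theorem weight_eq (d : Fin 5 → ℕ) (e : Fin 5 →₀ ℕ) : Finsupp.weight d e =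
    e 0 * d 0 + (e 1 * d 1 + (e 2 * d 2 + (e 3 * d 3 + e 4 * d 4))) := by
  rw [Finsupp.weight_apply, Finsupp.sum_fintype _ _ (by simp)]
  simp [Fin.sum_univ_succ]

/-- The image of a normally ordered monomial under a multiplicative map is controlled by the images
of the generators. -/
theorem map_mono_mem {B : Type*} [Ring B] [Algebra k B] {𝓖 : ℕ → Submodule k B}
    (h1 : (1 : B) ∈ 𝓖 0) (hmul : ∀ i j, ∀ x ∈ 𝓖 i, ∀ y ∈ 𝓖 j, x * y ∈ 𝓖 (i + j))
    (F : L k →ₐ[k] B) (d : Fin 5 → ℕ) (hF : ∀ g, F (gen k g) ∈ 𝓖 (d (idx g))) (e : Fin 5 →₀ ℕ) :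
    F (mono (e 0) (e 1) (e 2) (e 3) (e 4)) ∈ 𝓖 (Finsupp.weight d e) := by
  have hp := fun (g : Gen) (n : ℕ) => pow_mem_of_graded h1 hmul (hF g) n
  rw [weight_eq, mono, map_mul, map_mul, map_mul, map_mul, map_pow, map_pow, map_pow, map_pow,
    map_pow]
  exact hmul _ _ _ (hp .a _) _ (hmul _ _ _ (hp .b _) _ (hmul _ _ _ (hp .c _) _
    (hmul _ _ _ (hp .z _) _ (hp .w _))))

/-! ### The weight filtration is multiplicative, with commutative associated graded algebra -/

/-- `p` is the symbol of `f` in weight at most `m`. -/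
def HasSymbol (m : ℕ) (f : L k) (p : Poly k) : Prop :=
  p ∈ below k (m + 1) ∧ ∀ n, ∀ q ∈ below k (n + 1), rep f q - p * q ∈ below k (m + n)

theorem HasSymbol.apply_mem {m : ℕ} {f : L k} {p : Poly k} (h : HasSymbol m f p) {n : ℕ}
    {q : Poly k} (hq : q ∈ below k n) : rep f q ∈ below k (m + n) := by
  cases n with
  | zero =>
    have : q = 0 := by simpa [below_zero] using hq
    simp [this]
  | succ n =>
    have := Submodule.add_mem _ (below_mono (by omega) (h.2 n q hq)) (mul_mem_below h.1 hq)
    rwa [sub_add_cancel] at this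

theorem HasSymbol.mul {m n : ℕ} {f g : L k} {p q : Poly k} (hf : HasSymbol m f p)
    (hg : HasSymbol n g q) : HasSymbol (m + n) (f * g) (p * q) := by
  refine ⟨mul_mem_below hf.1 hg.1, fun l r hr => ?_⟩
  have h1 := hf.apply_mem (hg.2 l r hr)
  have h2 := hf.2 (n + l) (q * r) (mul_mem_below hg.1 hr)
  have := Submodule.add_mem _ h1 h2
  rw [map_sub, sub_add_sub_cancel] at this
  rwa [map_mul, Module.End.mul_apply, mul_assoc, add_assoc]

theorem HasSymbol.one : HasSymbol 0 (1 : L k) 1 :=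
  ⟨one_mem_below, fun n q _ => by simp⟩

theorem HasSymbol.pow {m : ℕ} {f : L k} {p : Poly k} (hf : HasSymbol m f p) (n : ℕ) :
    HasSymbol (n * m) (f ^ n) (p ^ n) := by
  induction n with
  | zero => simpa using HasSymbol.one
  | succ n ih => rw [pow_succ, pow_succ, add_mul, one_mul]; exact ih.mul hf

theorem HasSymbol.gen (g : Gen) : HasSymbol (wt (idx g)) (gen k g) (X (idx g)) := by
  refine ⟨X_mem_below _, fun n q hq => ?_⟩
  rw [rep_gen]
  cases g
  · simp [idx]
  · have h : X 2 * pderiv 0 q ∈ below k (1 + n) :=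
      X_mul_mem_below 2 (pderiv_mem_below 0 hq le_rfl)
    change _ ∈ below k (1 + n)
    simpa [idx] using h
  · simp [idx]
  · simp [idx]
  -- The operator c³∂_z raises weight by 3 − 2 = 1, less than the weight 2 of w, so it does not
  -- contribute to the symbol.
  · have h : C (3 : k)⁻¹ * (X 2 ^ 3 * pderiv 3 q) ∈ below k (2 + n) := by
      rw [← smul_eq_C_mul]
      refine Submodule.smul_mem _ _ ?_
      have h3 : pderiv 3 q ∈ below k (n - 1) := pderiv_mem_below 3 hq (by change n + 1 ≤ n - 1 + 2; omega)
      have : X 2 ^ 3 * pderiv 3 q = X 2 * (X 2 * (X 2 * pderiv 3 q)) := by ring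
      rw [this]
      have := X_mul_mem_below 2 (X_mul_mem_below 2 (X_mul_mem_below_of_pred 2 rfl h3))
      rwa [← add_assoc] at this
    change _ ∈ below k (2 + n)
    simpa [idx] using h

theorem HasSymbol.mono_weight {m n : ℕ} (h : m ≤ n) {f : L k} {p : Poly k} (hf : HasSymbol m f p) :
    HasSymbol n f p :=
  ⟨below_mono (by omega) hf.1, fun l q hq => below_mono (by omega) (hf.2 l q hq)⟩

theorem HasSymbol.add {m : ℕ} {f g : L k} {p q : Poly k} (hf : HasSymbol m f p)
    (hg : HasSymbol m g q) : HasSymbol m (f + g) (p + q) := by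
  refine ⟨Submodule.add_mem _ hf.1 hg.1, fun n r hr => ?_⟩
  have := Submodule.add_mem _ (hf.2 n r hr) (hg.2 n r hr)
  rwa [sub_add_sub_comm, ← add_mul, ← LinearMap.add_apply, ← map_add] at this

theorem HasSymbol.smul {m : ℕ} {f : L k} {p : Poly k} (r : k) (hf : HasSymbol m f p) :
    HasSymbol m (r • f) (r • p) := by
  refine ⟨Submodule.smul_mem _ r hf.1, fun n q hq => ?_⟩
  have := Submodule.smul_mem _ r (hf.2 n q hq)
  rwa [smul_sub, ← smul_mul_assoc, ← LinearMap.smul_apply, ← map_smul] at this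

theorem HasSymbol.zero (m : ℕ) : HasSymbol m (0 : L k) 0 :=
  ⟨Submodule.zero_mem _, fun n q _ => by simp⟩

theorem HasSymbol.mono (e : Fin 5 →₀ ℕ) : HasSymbol (Finsupp.weight wt e)
    (mono (e 0) (e 1) (e 2) (e 3) (e 4) : L k) (monomial e 1) := by
  rw [weight_eq, ← expo_eq e, monomial_expo, L.mono]
  exact ((HasSymbol.gen .a).pow _).mul (((HasSymbol.gen .b).pow _).mul (((HasSymbol.gen .c).pow _).mul
    (((HasSymbol.gen .z).pow _).mul ((HasSymbol.gen .w).pow _))))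

/-- Symbols add and multiply, and each variable is the symbol of its generator, so the PBW expansion
reduces the claim to generators. -/
theorem hasSymbol_of_mem {m : ℕ} {f : L k} (hf : toPoly f ∈ below k (m + 1)) :
    HasSymbol m f (toPoly f) := by
  have h : ∀ s : Finset (Fin 5 →₀ ℕ), (∀ e ∈ s, Finsupp.weight wt e ≤ m) → HasSymbol m
      (∑ e ∈ s, coeff e (toPoly f) • mono (e 0) (e 1) (e 2) (e 3) (e 4))
      (∑ e ∈ s, coeff e (toPoly f) • monomial e (1 : k)) := by
    classical
    intro s
    induction s using Finset.induction_on with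
    | empty => intro _; simpa using HasSymbol.zero m
    | insert e s he ih =>
      intro hs
      rw [Finset.sum_insert he, Finset.sum_insert he]
      exact (((HasSymbol.mono e).mono_weight (hs e (by simp))).smul _).add
        (ih fun d hd => hs d (by simp [hd]))
  have h' := h (toPoly f).support fun e he =>
    Nat.lt_succ_iff.1 (mem_below.1 hf e (mem_support_iff.1 he))
  rw [← eq_sum_mono] at h'
  convert h' using 1
  conv_lhs => rw [(toPoly f).as_sum]
  simp [smul_monomial]

variable (k) in
/-- The filtration of `L` by weight. -/
def fil (n : ℕ) : Submodule k (L k) := (below k (n + 1)).comap toPoly.toLinearMap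

theorem mem_fil {n : ℕ} {f : L k} : f ∈ fil k n ↔ toPoly f ∈ below k (n + 1) := Iff.rfl

theorem fil_mono : Monotone (fil k) := fun _ _ h => Submodule.comap_mono (below_mono (by omega))

/-- The reason the associated graded algebra is a commutative polynomial algebra: noncommutativity
only shows in lower weight. -/
theorem toPoly_mul_sub_mem {i j : ℕ} {f g : L k} (hf : f ∈ fil k i) (hg : g ∈ fil k j) :
    toPoly (f * g) - toPoly f * toPoly g ∈ below k (i + j) := by
  rw [toPoly_mul]
  exact (hasSymbol_of_mem hf).2 j _ hg

theorem mul_mem_fil (i j : ℕ) (f : L k) (hf : f ∈ fil k i) (g : L k) (hg : g ∈ fil k j) :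
    f * g ∈ fil k (i + j) := by
  rw [mem_fil, toPoly_mul]
  exact (hasSymbol_of_mem hf).apply_mem hg

theorem one_mem_fil : (1 : L k) ∈ fil k 0 := by
  rw [mem_fil, toPoly_one]; exact one_mem_below

theorem gen_mem_fil (g : Gen) : gen k g ∈ fil k (wt (idx g)) := by
  rw [mem_fil, toPoly_gen]; exact X_mem_below _

theorem fil_zero : fil k 0 = 1 := by
  apply le_antisymm
  · intro f hf
    refine Submodule.mem_one.2 ⟨constantCoeff (toPoly f), toPoly.injective ?_⟩
    rw [toPoly_algebraMap]
    exact (eq_C_of_mem_below_one hf).symm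
  · exact Submodule.one_le.2 one_mem_fil

/-! ### The coradical filtration -/

variable [CharZero k]

/-- The degrees are left arbitrary because the result serves both the weights 1, 1, 1, 2, 2 and the
degrees 1, 1, 2, 3, 3. The only constraints come from the terms a ⊗ c and b ⊗ c. -/
theorem comul_gen_mem_tensorFil {𝓕 : ℕ → Submodule k (L k)} (d : Fin 5 → ℕ) (h1 : 1 ∈ 𝓕 0)
    (hg : ∀ g, gen k g ∈ 𝓕 (d (idx g))) (hz : d 3 = d 0 + d 2) (hw : d 4 = d 1 + d 2) (g : Gen) :
    Coalgebra.comul (R := k) (gen k g) ∈ tensorFil 𝓕 (d (idx g)) := by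
  have hl : ∀ g, (1 : L k) ⊗ₜ[k] gen k g ∈ tensorFil 𝓕 (d (idx g)) := fun g =>
    tmul_mem_tensorFil (zero_add _) h1 (hg g)
  have hr : ∀ g, gen k g ⊗ₜ[k] (1 : L k) ∈ tensorFil 𝓕 (d (idx g)) := fun g =>
    tmul_mem_tensorFil (add_zero _) (hg g) h1
  rw [comul_gen]
  cases g
  · exact Submodule.add_mem _ (hl _) (hr _)
  · exact Submodule.add_mem _ (hl _) (hr _)
  · exact Submodule.add_mem _ (hl _) (hr _)
  · exact Submodule.add_mem _ (Submodule.sub_mem _ (Submodule.add_mem _ (hl _)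
      (tmul_mem_tensorFil hz.symm (hg .a) (hg .c)))
      (tmul_mem_tensorFil ((add_comm _ _).trans hz.symm) (hg .c) (hg .a))) (hr _)
  · exact Submodule.add_mem _ (Submodule.sub_mem _ (Submodule.add_mem _ (hl _)
      (tmul_mem_tensorFil hw.symm (hg .b) (hg .c)))
      (tmul_mem_tensorFil ((add_comm _ _).trans hw.symm) (hg .c) (hg .b))) (hr _)

theorem comul_mono_mem_tensorFil {𝓕 : ℕ → Submodule k (L k)} (d : Fin 5 → ℕ) (h1 : 1 ∈ 𝓕 0)
    (hmul : ∀ i j, ∀ x ∈ 𝓕 i, ∀ y ∈ 𝓕 j, x * y ∈ 𝓕 (i + j))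
    (hg : ∀ g, gen k g ∈ 𝓕 (d (idx g))) (hz : d 3 = d 0 + d 2) (hw : d 4 = d 1 + d 2)
    (e : Fin 5 →₀ ℕ) :
    Coalgebra.comul (R := k) (mono (e 0) (e 1) (e 2) (e 3) (e 4) : L k) ∈
      tensorFil 𝓕 (Finsupp.weight d e) :=
  map_mono_mem (tmul_mem_tensorFil (zero_add 0) h1 h1) (fun _ _ _ hx _ hy => mul_mem_tensorFil hmul hx hy)
    (Bialgebra.comulAlgHom k (L k)) d (comul_gen_mem_tensorFil d h1 hg hz hw) e

theorem comul_mem_tensorFil_fil {n : ℕ} {f : L k} (hf : f ∈ fil k n) :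
    Coalgebra.comul (R := k) f ∈ tensorFil (fil k) n := by
  rw [eq_sum_mono f, map_sum]
  refine Submodule.sum_mem _ fun e he => ?_
  rw [map_smul]
  refine Submodule.smul_mem _ _ (tensorFil_mono fil_mono (Nat.lt_succ_iff.1
    (mem_below.1 hf e (mem_support_iff.1 he))) ?_)
  exact comul_mono_mem_tensorFil wt one_mem_fil mul_mem_fil gen_mem_fil rfl rfl e

/-- For ⊆, contractions kill k ⊗ L and send L ⊗ Lₙ into Lₙ, so all three fields lower the weight and
`mem_below_of_field` applies. For ⊇, Δ respects weight: a summand Lᵢ ⊗ Lⱼ of total weight n + 1 lies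
in L ⊗ Lₙ if i ≥ 1 and in k ⊗ L if i = 0. -/
theorem coradicalFiltration_eq : coradicalFiltration k (L k) = fil k := by
  have hc : coradical k (L k) = 1 := isConnected
  funext n
  induction n with
  | zero => rw [fil_zero]; exact hc
  | succ n ih =>
    rw [coradicalFiltration, ih, hc]
    apply le_antisymm
    · intro f hf
      refine mem_below_of_field fun i => ?_
      change field i (toPoly f) ∈ _
      rw [← toPoly_coDeriv]
      obtain ⟨s, hs, t, ht, hst⟩ := Submodule.mem_sup.1 hf
      have ht0 : contract (linCoeff (primIdx i)) t = 0 := by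
        clear hst
        rw [tensorSub_eq_span] at ht
        induction ht using Submodule.span_induction with
        | mem t ht =>
          obtain ⟨x, hx, y, _, rfl⟩ := ht
          obtain ⟨r, rfl⟩ := Submodule.mem_one.1 hx
          rw [contract_tmul, Algebra.algebraMap_eq_smul_one, map_smul, linCoeff_one, smul_zero,
            zero_smul]
        | zero => simp
        | add t t' _ _ h h' => rw [map_add, h, h', add_zero]
        | smul r t _ h => rw [map_smul, h, smul_zero]
      rw [coDeriv, ← hst, map_add, ht0, add_zero]
      exact contract_mem _ hs
    · intro f hf
      suffices h : tensorFil (fil k) (n + 1) ≤ tensorSub k ⊤ (fil k n) ⊔ tensorSub k 1 ⊤ from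
        h (comul_mem_tensorFil_fil hf)
      refine iSup_le fun i => iSup_le fun j => iSup_le fun h => ?_
      cases i with
      | zero => exact le_sup_of_le_right (tensorSub_mono (by rw [fil_zero]) le_top)
      | succ i => exact le_sup_of_le_left (tensorSub_mono le_top (fil_mono (by omega)))

end L

end ConnectedHopf

namespace ConnectedHopf

namespace L

open MvPolynomial

variable {k : Type u} [Field k]

/-! ### The signature -/

theorem sub_component_mem_below {n : ℕ} {p : Poly k} (hp : p ∈ below k (n + 1)) :
    p - weightedHomogeneousComponent wt n p ∈ below k n := by
  classical
  rw [mem_below] at *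
  intro e he
  rw [coeff_sub, coeff_weightedHomogeneousComponent] at he
  split_ifs at he with h
  · simp at he
  · rw [sub_zero] at he
    have := hp e he
    omega

theorem component_eq_zero_of_mem_below {n : ℕ} {p : Poly k} (hp : p ∈ below k n) :
    weightedHomogeneousComponent wt n p = 0 := by
  classical
  ext e
  rw [coeff_weightedHomogeneousComponent, coeff_zero]
  split_ifs with h
  · by_contra hne
    have := mem_below.1 hp e hne
    omega
  · rfl

theorem mem_below_of_component_eq_zero {n : ℕ} {p : Poly k} (hp : p ∈ below k (n + 1))
    (h : weightedHomogeneousComponent wt n p = 0) : p ∈ below k n := by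
  simpa [h] using sub_component_mem_below hp

theorem mem_below_of_isWeightedHomogeneous {n : ℕ} {p : Poly k} (hp : IsWeightedHomogeneous wt p n) :
    p ∈ below k (n + 1) :=
  mem_below.2 fun _ he => Nat.lt_succ_iff.2 (hp he).le

/-- Replacing both factors by their top components changes the product only in lower weight. -/
theorem component_mul {i j : ℕ} {p q : Poly k} (hp : p ∈ below k (i + 1)) (hq : q ∈ below k (j + 1)) :
    weightedHomogeneousComponent wt (i + j) (p * q) =
      weightedHomogeneousComponent wt i p * weightedHomogeneousComponent wt j q := by
  set p₀ := weightedHomogeneousComponent wt i p with hp₀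
  set q₀ := weightedHomogeneousComponent wt j q with hq₀
  have hhp : IsWeightedHomogeneous wt p₀ i := weightedHomogeneousComponent_isWeightedHomogeneous _ _
  have hhq : IsWeightedHomogeneous wt q₀ j := weightedHomogeneousComponent_isWeightedHomogeneous _ _
  have e : p * q = p₀ * q₀ + (q * (p - p₀) + p₀ * (q - q₀)) := by ring
  have h1 : q * (p - p₀) ∈ below k (i + j) := by
    rw [add_comm]; exact mul_mem_below_of_mem hq (sub_component_mem_below hp)
  have h2 : p₀ * (q - q₀) ∈ below k (i + j) :=
    mul_mem_below_of_mem (mem_below_of_isWeightedHomogeneous hhp) (sub_component_mem_below hq)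
  rw [e, map_add, component_eq_zero_of_mem_below (Submodule.add_mem _ h1 h2), add_zero]
  exact (hhp.mul hhq).weightedHomogeneousComponent_same

variable (k) in
/-- Elements of `L` of weight less than `n`. -/
def filLt (n : ℕ) : Submodule k (L k) := (below k n).comap toPoly.toLinearMap

instance : IsRingFiltration (fil k) (filLt k) where
  mono := fil_mono
  is_le h := Submodule.comap_mono (below_mono (Nat.succ_le_of_lt h))
  is_sup B j h := by
    cases j with
    | zero =>
      intro f hf
      have : toPoly f = 0 := by simpa [filLt, below_zero] using hf
      rw [toPoly.map_eq_zero_iff.1 this]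
      exact B.zero_mem
    | succ j => exact h j (Nat.lt_succ_self j)
  one_mem := one_mem_fil
  mul_mem i j f g hf hg := mul_mem_fil i j f hf g hg

/-- The leading form of an element of the associated graded algebra. -/
def leadingForm (m : ℕ) : GrPiece (fil k) (filLt k) m →ₗ[k] Poly k :=
  Submodule.liftQ _ (weightedHomogeneousComponent wt m ∘ₗ toPoly.toLinearMap ∘ₗ (fil k m).subtype)
    fun _ hx => component_eq_zero_of_mem_below hx

theorem leadingForm_mk (m : ℕ) (x : fil k m) : leadingForm m (GrPiece.mk (fil k) (filLt k) m x) =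
    weightedHomogeneousComponent wt m (toPoly (x : L k)) :=
  rfl

theorem leadingForm_isWeightedHomogeneous (m : ℕ) (x : GrPiece (fil k) (filLt k) m) :
    IsWeightedHomogeneous wt (leadingForm m x) m := by
  obtain ⟨x, rfl⟩ := GrPiece.mk_surjective (fil k) (filLt k) m x
  exact weightedHomogeneousComponent_isWeightedHomogeneous _ _

theorem leadingForm_injective (m : ℕ) (x : GrPiece (fil k) (filLt k) m) (h : leadingForm m x = 0) :
    x = 0 := by
  obtain ⟨x, rfl⟩ := GrPiece.mk_surjective (fil k) (filLt k) m x
  exact GrPiece.mk_eq_zero _ _ (mem_below_of_component_eq_zero x.2 h)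

/-- The leading forms define an algebra homomorphism on the associated graded algebra. -/
def grToPoly : (⨁ m, GrPiece (fil k) (filLt k) m) →ₐ[k] Poly k :=
  DirectSum.toAlgebra k _ leadingForm
    (by
      refine (leadingForm_mk 0 ⟨1, one_mem_fil⟩).trans ?_
      rw [toPoly_one]
      exact (isWeightedHomogeneous_one k wt).weightedHomogeneousComponent_same)
    (by
      intro i j x y
      obtain ⟨x, rfl⟩ := GrPiece.mk_surjective (fil k) (filLt k) i x
      obtain ⟨y, rfl⟩ := GrPiece.mk_surjective (fil k) (filLt k) j y
      refine (leadingForm_mk (i + j) ⟨(x : L k) * (y : L k), mul_mem_fil i j _ x.2 _ y.2⟩).trans ?_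
      have h := component_eq_zero_of_mem_below (toPoly_mul_sub_mem x.2 y.2)
      rw [map_sub, sub_eq_zero] at h
      rw [h, leadingForm_mk, leadingForm_mk]
      exact component_mul x.2 y.2)

theorem grToPoly_of (m : ℕ) (x : GrPiece (fil k) (filLt k) m) :
    grToPoly (DirectSum.of _ m x) = leadingForm m x :=
  DirectSum.toAddMonoid_of _ _ _

/-- Leading forms of different degrees do not interfere, so injectivity of `grToPoly` reduces to
that of each `leadingForm`. -/
theorem component_grToPoly (m : ℕ) (x : ⨁ m, GrPiece (fil k) (filLt k) m) :
    weightedHomogeneousComponent wt m (grToPoly x) = leadingForm m (x m) := by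
  classical
  induction x using DirectSum.induction_on with
  | zero => simp
  | add x y hx hy => rw [map_add, map_add, hx, hy, DirectSum.add_apply, map_add]
  | of i x =>
    rw [grToPoly_of]
    by_cases h : i = m
    · subst h
      rw [DirectSum.of_eq_same]
      exact (leadingForm_isWeightedHomogeneous i x).weightedHomogeneousComponent_same
    · rw [DirectSum.of_eq_of_ne _ _ _ (Ne.symm h), map_zero]
      exact (leadingForm_isWeightedHomogeneous i x).weightedHomogeneousComponent_ne m (Ne.symm h)

theorem grToPoly_bijective : Function.Bijective (grToPoly (k := k)) := by
  constructor
  · rw [injective_iff_map_eq_zero]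
    intro x hx
    refine DFinsupp.ext fun m => leadingForm_injective m _ ?_
    rw [← component_grToPoly, hx, map_zero]
  · have hmon : ∀ (e : Fin 5 →₀ ℕ) (r : k), monomial e r ∈ (grToPoly (k := k)).range := by
      intro e r
      have hh : IsWeightedHomogeneous wt (monomial e r : Poly k) (Finsupp.weight wt e) :=
        isWeightedHomogeneous_monomial _ _ _ rfl
      refine ⟨DirectSum.of _ (Finsupp.weight wt e) (GrPiece.mk _ _ _ ⟨toPoly.symm (monomial e r), ?_⟩), ?_⟩
      · rw [mem_fil, LinearEquiv.apply_symm_apply]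
        exact monomial_mem_below e r
      · refine (grToPoly_of _ _).trans ?_
        rw [leadingForm_mk]
        simp only [LinearEquiv.apply_symm_apply]
        exact hh.weightedHomogeneousComponent_same
    intro p
    change p ∈ (grToPoly (k := k)).range
    rw [p.as_sum]
    exact Subalgebra.sum_mem _ fun e _ => hmon e _

/-- Stated for families merely equal to the weight filtration, so that `subst` deals with the
dependence of the types `GrPiece` on the filtration. -/
theorem exists_gr_algEquiv {F Flt : ℕ → Submodule k (L k)} (hF : F = fil k) (hFlt : Flt = filLt k) :
    ∃ (_ : IsRingFiltration F Flt) (e : (⨁ m, GrPiece F Flt m) ≃ₐ[k] MvPolynomial (Fin 5) k),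
      ∀ (m : ℕ) (x : GrPiece F Flt m), IsWeightedHomogeneous wt (e (DirectSum.of _ m x)) m := by
  subst hF hFlt
  refine ⟨inferInstance, AlgEquiv.ofBijective grToPoly grToPoly_bijective, fun m x => ?_⟩
  have h : AlgEquiv.ofBijective grToPoly grToPoly_bijective (DirectSum.of _ m x) = leadingForm m x :=
    grToPoly_of m x
  rw [h]
  exact leadingForm_isWeightedHomogeneous m x

theorem hasSignature [CharZero k] : HasSignature k (L k) ![1, 1, 1, 2, 2] := by
  refine exists_gr_algEquiv coradicalFiltration_eq (funext fun n => ?_)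
  cases n with
  | zero =>
    -- The convention L₋₁ = 0 agrees with the absence of weights below 0.
    refine (eq_bot_iff.2 fun f hf => ?_ : filLt k 0 = ⊥).symm
    have : toPoly f = 0 := by simpa [filLt, below_zero] using hf
    exact (Submodule.mem_bot k).2 (toPoly.map_eq_zero_iff.1 this)
  | succ n => exact congrFun coradicalFiltration_eq n

/-! ### The connected grading -/

/-- The degrees of `a, b, c, z, w`. -/
def dg : Fin 5 → ℕ := ![1, 1, 2, 3, 3]

variable (k) in
/-- The homogeneous components of `L`. -/
def grading (m : ℕ) : Submodule k (L k) :=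
  (weightedHomogeneousSubmodule k dg m).comap toPoly.toLinearMap

theorem mem_grading {m : ℕ} {f : L k} :
    f ∈ grading k m ↔ IsWeightedHomogeneous dg (toPoly f) m := Iff.rfl

theorem pderiv_eq_zero_of_lt {d : Fin 5 → ℕ} {n : ℕ} {p : Poly k} (hp : IsWeightedHomogeneous d p n)
    {i : Fin 5} (h : n < d i) : pderiv i p = 0 := by
  ext e
  rw [coeff_pderiv, coeff_zero]
  refine mul_eq_zero_of_left ?_ _
  by_contra hne
  have := hp hne
  rw [map_add, Finsupp.weight_single, one_smul] at this
  omega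

/-- `X ^ s ∂ᵢ` is homogeneous. -/
theorem isWeightedHomogeneous_mul_pderiv {d : Fin 5 → ℕ} {n m s : ℕ} {p q : Poly k} (i : Fin 5)
    (hp : IsWeightedHomogeneous d p n) (hq : IsWeightedHomogeneous d q s) (h : m + d i = s) :
    IsWeightedHomogeneous d (q * pderiv i p) (m + n) := by
  -- Below degree `d i` the derivative vanishes; otherwise n − `d i` is not truncated.
  by_cases hn : n < d i
  · rw [pderiv_eq_zero_of_lt hp hn, mul_zero]
    exact isWeightedHomogeneous_zero _ _ _
  · have := hq.mul (hp.pderiv (i := i) (n' := n - d i) (by omega))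
    convert this using 1
    omega

/-- Operators homogeneous of degree `m`. -/
def homOp (m : ℕ) : Submodule k (Module.End k (Poly k)) where
  carrier := {T | ∀ n p, IsWeightedHomogeneous dg p n → IsWeightedHomogeneous dg (T p) (m + n)}
  add_mem' hS hT n p hp := (hS n p hp).add (hT n p hp)
  zero_mem' _ _ _ := isWeightedHomogeneous_zero _ _ _
  smul_mem' r _ hT n p hp := (weightedHomogeneousSubmodule k dg (m + n)).smul_mem r (hT n p hp)

theorem leftOp_mem_homOp (g : Gen) : (leftOp g : Module.End k (Poly k)) ∈ homOp (dg (idx g)) := by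
  intro n p hp
  have hX : ∀ i, IsWeightedHomogeneous dg (X i * p) (dg i + n) := fun i =>
    (isWeightedHomogeneous_X k dg i).mul hp
  cases g
  · exact hX 0
  · rw [leftOp_b]
    exact (hX 1).sub (isWeightedHomogeneous_mul_pderiv 0 hp (isWeightedHomogeneous_X k dg 2) rfl)
  · exact hX 2
  · exact hX 3
  · rw [leftOp_w]
    refine (hX 4).sub (IsWeightedHomogeneous.C_mul ?_ _)
    exact isWeightedHomogeneous_mul_pderiv 3 hp ((isWeightedHomogeneous_X k dg 2).pow 3) rfl

/-- It is enough to treat generators: for the degrees 1, 1, 2, 3, 3 the operator c∂_a has degree 1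
like b, and c³∂_z has degree 3 like w. -/
theorem rep_mem_homOp {m : ℕ} {f : L k} (hf : f ∈ grading k m) : rep f ∈ homOp (k := k) m := by
  rw [eq_sum_mono f, map_sum]
  refine Submodule.sum_mem _ fun e he => ?_
  rw [map_smul]
  refine Submodule.smul_mem _ _ ?_
  have h : Finsupp.weight dg e = m := hf (mem_support_iff.1 he)
  rw [← h]
  refine map_mono_mem (𝓖 := homOp (k := k)) ?_ ?_ rep dg (fun g => by
    rw [rep_gen]; exact leftOp_mem_homOp g) e
  · intro n p hp
    simpa using hp
  · intro i j S hS T hT n p hp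
    rw [add_assoc]
    exact hS _ _ (hT _ _ hp)

theorem mul_mem_grading (i j : ℕ) (f : L k) (hf : f ∈ grading k i) (g : L k) (hg : g ∈ grading k j) :
    f * g ∈ grading k (i + j) := by
  rw [mem_grading, toPoly_mul]
  exact rep_mem_homOp hf _ _ hg

theorem one_mem_grading : (1 : L k) ∈ grading k 0 := by
  rw [mem_grading, toPoly_one]; exact isWeightedHomogeneous_one _ _

theorem gen_mem_grading (g : Gen) : gen k g ∈ grading k (dg (idx g)) := by
  rw [mem_grading, toPoly_gen]; exact isWeightedHomogeneous_X _ _ _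

theorem isConnectedGradedAlgebra : IsConnectedGradedAlgebra (grading k) where
  gradedMonoid :=
    { one_mem := one_mem_grading
      mul_mem := fun i j f g hf hg => mul_mem_grading i j f hf g hg }
  isInternal := by
    have h : DirectSum.IsInternal (weightedHomogeneousSubmodule k dg) := by
      let := weightedDecomposition k dg
      exact DirectSum.Decomposition.isInternal _
    rw [DirectSum.isInternal_submodule_iff_iSupIndep_and_iSup_eq_top] at h ⊢
    -- Independence and spanning are transported from the weighted grading of polynomials along the
    -- lattice isomorphism induced by `toPoly`.
    let o : Submodule k (Poly k) ≃o Submodule k (L k) := (Submodule.orderIsoMapComap toPoly).symm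
    have ho : grading k = o ∘ weightedHomogeneousSubmodule k dg := rfl
    rw [ho]
    refine ⟨h.1.map_orderIso o, ?_⟩
    have := o.map_iSup (weightedHomogeneousSubmodule k dg)
    rw [h.2, o.map_top] at this
    exact this.symm
  zero_eq := by
    apply le_antisymm
    · intro f hf
      refine Submodule.mem_one.2 ⟨constantCoeff (toPoly f), toPoly.injective ?_⟩
      rw [toPoly_algebraMap]
      -- The bound concerns the weights `wt`, but degree 0 for the positive degrees `dg` already
      -- forces the exponent to be zero.
      refine (eq_C_of_mem_below_one (mem_below.2 fun e he => ?_)).symm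
      have h0 : Finsupp.weight dg e = 0 := hf he
      have := Finsupp.nonTorsionWeight_of (R := ℕ) (w := dg) (by decide)
      rw [Finsupp.weight_eq_zero_iff_eq_zero] at h0
      simp [h0]
    · exact Submodule.one_le.2 one_mem_grading

variable (k) in
/-- The homogeneous components of the opposite algebra of `L`. -/
def gradingOp (m : ℕ) : Submodule k (L k)ᵐᵒᵖ :=
  (grading k m).comap (MulOpposite.opLinearEquiv k).symm.toLinearMap

theorem mem_gradingOp {m : ℕ} {x : (L k)ᵐᵒᵖ} : x ∈ gradingOp k m ↔ x.unop ∈ grading k m := Iff.rfl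

/-- Viewed as a map into the opposite algebra the antipode is multiplicative, so `map_mono_mem`
applies. -/
theorem antipodeHom_mem_gradingOp [CharZero k] {m : ℕ} {f : L k} (hf : f ∈ grading k m) :
    antipodeHom f ∈ gradingOp k m := by
  have h1 : (1 : (L k)ᵐᵒᵖ) ∈ gradingOp k 0 := by
    rw [mem_gradingOp, MulOpposite.unop_one]; exact one_mem_grading
  have hmul : ∀ i j, ∀ x ∈ gradingOp k i, ∀ y ∈ gradingOp k j, x * y ∈ gradingOp k (i + j) := by
    intro i j x hx y hy
    rw [mem_gradingOp, MulOpposite.unop_mul, add_comm]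
    exact mul_mem_grading j i _ hy _ hx
  have hgen : ∀ g, antipodeHom (gen k g) ∈ gradingOp k (dg (idx g)) := by
    intro g
    have : antipodeHom (gen k g) = MulOpposite.op (-gen k g) := by simp [antipodeHom]
    rw [this, mem_gradingOp, MulOpposite.unop_op]
    exact Submodule.neg_mem _ (gen_mem_grading g)
  rw [eq_sum_mono f, map_sum]
  refine Submodule.sum_mem _ fun e he => ?_
  rw [map_smul]
  refine Submodule.smul_mem _ _ ?_
  have h : Finsupp.weight dg e = m := hf (mem_support_iff.1 he)
  rw [← h]
  exact map_mono_mem h1 hmul antipodeHom dg hgen e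

theorem isHopfGrading [CharZero k] : IsHopfGrading (grading k) where
  comul_mem m f hf := by
    change _ ∈ tensorFil (grading k) m
    rw [eq_sum_mono f, map_sum]
    refine Submodule.sum_mem _ fun e he => ?_
    rw [map_smul]
    refine Submodule.smul_mem _ _ ?_
    have h : Finsupp.weight dg e = m := hf (mem_support_iff.1 he)
    rw [← h]
    exact comul_mono_mem_tensorFil dg one_mem_grading mul_mem_grading gen_mem_grading rfl rfl e
  counit_eq_zero m hm f hf := by
    rw [counit_eq, constantCoeff_eq]
    by_contra hne
    have h0 := hf hne
    rw [map_zero] at h0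
    exact hm h0.symm
  antipode_mem m f hf := by
    have h := antipodeHom_mem_gradingOp hf
    exact h

end L

end ConnectedHopf

namespace ConnectedHopf

/-! ### Ore extensions of derivation type inside an ambient algebra -/

section Ore

variable {k : Type u} {A : Type v} [Field k] [Ring A] [Algebra k A]

/-- The map `∑ rⱼ Xʲ ↦ ∑ rⱼ xʲ` with coefficients in a subalgebra. -/
def oreMap (R : Subalgebra k A) (x : A) : (ℕ →₀ R) →ₗ[k] A :=
  Finsupp.lsum k fun j => LinearMap.mulRight k (x ^ j) ∘ₗ R.val.toLinearMap

theorem oreMap_apply (R : Subalgebra k A) (x : A) (f : ℕ →₀ R) :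
    oreMap R x f = f.sum fun j r => (r : A) * x ^ j :=
  rfl

/-- A criterion for a differential operator extension. -/
theorem isOreExtension_of_commutator_mem {R T : Subalgebra k A} {x : A} (hRT : R ≤ T) (hx : x ∈ T)
    (hT : T ≤ Algebra.adjoin k (insert x (R : Set A))) (hc : ∀ r ∈ R, x * r - r * x ∈ R)
    (hinj : ∀ f, oreMap R x f = 0 → f = 0) : IsOreExtension R T := by
  -- Here σ is the identity and δ is the commutator with x.
  refine ⟨AlgEquiv.refl,
    { toFun := fun r => ⟨x * r - r * x, hc r r.2⟩
      map_add' := fun r s => Subtype.ext (by simp only [R.coe_add, mul_add, add_mul]; abel)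
      map_smul' := fun t r => Subtype.ext (by simp [smul_sub]) }, x, ?_, ?_, ?_, ?_⟩
  · intro r s
    refine Subtype.ext ?_
    simp only [LinearMap.coe_mk, AddHom.coe_mk, R.coe_mul, R.coe_add, AlgEquiv.coe_refl, id_eq]
    noncomm_ring
  · intro r
    simp
  · exact (injective_iff_map_eq_zero (oreMap R x)).2 hinj
  · apply Set.Subset.antisymm
    · rintro _ ⟨f, rfl⟩
      exact Subalgebra.sum_mem _ fun j _ => T.mul_mem (hRT (f j).2) (T.pow_mem hx j)
    · intro t ht
      -- The range of `oreMap` is stable under left multiplication by R and by x, hence by T, and it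
      -- contains 1.
      have hr : ∀ r ∈ R, ∀ y ∈ LinearMap.range (oreMap R x), r * y ∈ LinearMap.range (oreMap R x) := by
        rintro r hr _ ⟨f, rfl⟩
        induction f using Finsupp.induction_linear with
        | zero => simp
        | add f g hf hg => rw [map_add, mul_add]; exact Submodule.add_mem _ hf hg
        | single j s =>
          exact ⟨Finsupp.single j (⟨r, hr⟩ * s), by
            simp only [oreMap, Finsupp.lsum_single, LinearMap.comp_apply,
              LinearMap.mulRight_apply, AlgHom.toLinearMap_apply, Subalgebra.coe_val, R.coe_mul,
              mul_assoc]⟩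
      have hxm : ∀ y ∈ LinearMap.range (oreMap R x), x * y ∈ LinearMap.range (oreMap R x) := by
        rintro _ ⟨f, rfl⟩
        induction f using Finsupp.induction_linear with
        | zero => simp
        | add f g hf hg => rw [map_add, mul_add]; exact Submodule.add_mem _ hf hg
        | single j s =>
          refine ⟨Finsupp.single (j + 1) s + Finsupp.single j ⟨_, hc s s.2⟩, ?_⟩
          simp only [oreMap, map_add, Finsupp.lsum_single, LinearMap.comp_apply,
            LinearMap.mulRight_apply, AlgHom.toLinearMap_apply, Subalgebra.coe_val, pow_succ']
          noncomm_ring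
      have key : ∀ y ∈ LinearMap.range (oreMap R x), t * y ∈ LinearMap.range (oreMap R x) := by
        have ht' := hT ht
        clear ht
        induction ht' using Algebra.adjoin_induction with
        | mem t ht =>
          rcases ht with rfl | ht
          · exact hxm
          · exact hr t ht
        | algebraMap r => intro y hy; rw [← Algebra.smul_def]; exact Submodule.smul_mem _ r hy
        | add s t _ _ hs ht =>
          intro y hy; rw [add_mul]; exact Submodule.add_mem _ (hs y hy) (ht y hy)
        | mul s t _ _ hs ht => intro y hy; rw [mul_assoc]; exact hs _ (ht y hy)
      obtain ⟨f, hf⟩ := key 1 ⟨Finsupp.single 0 1, by simp [oreMap]⟩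
      exact ⟨f, by rw [mul_one] at hf; exact hf⟩

end Ore

namespace L

open MvPolynomial

variable {k : Type u} [Field k]

/-! ### The iterated Ore extension -/

/-- The position in which a generator is adjoined. -/
def rank : Gen → ℕ
  | .c => 0
  | .a => 1
  | .b => 2
  | .z => 3
  | .w => 4

theorem rank_injective : Function.Injective rank := by
  intro g h; cases g <;> cases h <;> simp [rank]

variable (k) in
/-- The subalgebra generated by the first `i` generators, in the order `c, a, b, z, w`. -/
def chain (i : ℕ) : Subalgebra k (L k) := Algebra.adjoin k (gen k '' {g | rank g < i})

theorem gen_mem_chain {g : Gen} {i : ℕ} (h : rank g < i) : gen k g ∈ chain k i :=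
  Algebra.subset_adjoin ⟨g, h, rfl⟩

theorem chain_le {i : ℕ} {S : Subalgebra k (L k)} (h : ∀ g, rank g < i → gen k g ∈ S) :
    chain k i ≤ S := by
  refine Algebra.adjoin_le ?_
  rintro _ ⟨g, hg, rfl⟩
  exact h g hg

theorem chain_five : chain k 5 = ⊤ := by
  refine Algebra.eq_top_iff.2 fun f => ?_
  induction f using L.induction with
  | halg r => exact Subalgebra.algebraMap_mem _ r
  | hgen g => exact gen_mem_chain (by cases g <;> simp [rank])
  | hmul x y hx hy => exact Subalgebra.mul_mem _ hx hy
  | hadd x y hx hy => exact Subalgebra.add_mem _ hx hy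

theorem chain_zero : chain k 0 = ⊥ := by simp [chain]

theorem gen_commutator_mem_chain {g h : Gen} (hgh : rank h < rank g) :
    gen k g * gen k h - gen k h * gen k g ∈ chain k (rank g) := by
  have hz : ∀ {x y : L k}, x = y → x - y ∈ chain k (rank g) := fun e => by
    rw [e, sub_self]; exact Subalgebra.zero_mem _
  cases g <;> cases h <;> simp [rank] at hgh
  · exact hz ca.symm
  · rw [ba, sub_sub_cancel_left]
    exact Subalgebra.neg_mem _ (gen_mem_chain (by simp [rank]))
  · exact hz cb.symm
  · exact hz za
  · exact hz zb
  · exact hz zc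
  · exact hz wa
  · exact hz wb
  · exact hz wc
  · rw [wz, sub_sub_cancel_left]
    exact Subalgebra.neg_mem _ (Subalgebra.smul_mem _
      (Subalgebra.pow_mem _ (gen_mem_chain (by simp [rank])) _) _)

theorem commutator_mem_chain (g : Gen) {r : L k} (hr : r ∈ chain k (rank g)) :
    gen k g * r - r * gen k g ∈ chain k (rank g) := by
  induction hr using Algebra.adjoin_induction with
  | mem r hr =>
    obtain ⟨h, hh, rfl⟩ := hr
    exact gen_commutator_mem_chain hh
  | algebraMap t => rw [Algebra.commutes, sub_self]; exact Subalgebra.zero_mem _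
  | add r s _ _ hr hs =>
    convert Subalgebra.add_mem _ hr hs using 1
    noncomm_ring
  | mul r s hr' hs' hr hs =>
    convert Subalgebra.add_mem _ (Subalgebra.mul_mem _ hr hs') (Subalgebra.mul_mem _ hr' hs) using 1
    noncomm_ring

/-- A centralizer is a subalgebra, so generators suffice. It is applied with T the multiplication
by, or the derivative in, the variable being adjoined. -/
theorem rep_commute_of_mem_chain {i : ℕ} {T : Module.End k (Poly k)}
    (hT : ∀ h, rank h < i → Commute (leftOp h) T) {r : L k} (hr : r ∈ chain k i) :
    Commute (rep r) T := by
  have : chain k i ≤ (Subalgebra.centralizer k {T}).comap rep := chain_le fun g hg => by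
    rw [Subalgebra.mem_comap, Subalgebra.mem_centralizer_iff]
    rintro _ rfl
    rw [rep_gen]
    exact (hT g hg).symm.eq
  have h := this hr
  rw [Subalgebra.mem_comap, Subalgebra.mem_centralizer_iff] at h
  exact (h T rfl).symm

theorem leftOp_commute_mulOp {g h : Gen} (hgh : rank h < rank g) :
    Commute (leftOp h : Module.End k (Poly k)) (mulOp (X (idx g))) := by
  refine LinearMap.ext fun p => ?_
  cases g <;> cases h <;> simp [rank] at hgh <;>
  · simp [idx, pderiv_X]
    try ring

theorem leftOp_commute_dOp {g h : Gen} (hgh : rank h < rank g) :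
    Commute (leftOp h : Module.End k (Poly k)) (dOp (idx g)) := by
  refine LinearMap.ext fun p => ?_
  cases g <;> cases h <;> simp [rank] at hgh <;>
  simp [idx, pderiv_X, pderiv_comm 3 0, pderiv_comm 4 0]

/-- Elements of the preceding stage act by operators commuting with multiplication by the new
variable, so no reordering occurs. -/
theorem toPoly_mul_gen_pow {g : Gen} {r : L k} (hr : r ∈ chain k (rank g)) (j : ℕ) :
    toPoly (r * gen k g ^ j) = toPoly r * X (idx g) ^ j := by
  have hc := rep_commute_of_mem_chain (fun h hh => leftOp_commute_mulOp (g := g) hh) hr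
  have h1 : ∀ j : ℕ, toPoly (gen k g ^ j) = X (idx g) ^ j := by
    intro j
    induction j with
    | zero => simp
    | succ j ih =>
      have hd : ∀ i, i ≠ idx g → pderiv i (X (idx g) ^ j : Poly k) = 0 := fun i hi => by
        rw [Derivation.leibniz_pow, pderiv_X_of_ne (Ne.symm hi)]; simp
      rw [pow_succ', toPoly_gen_mul, ih, pow_succ']
      cases g <;> simp [idx] at hd ⊢
  rw [toPoly_mul, h1]
  have h2 := LinearMap.congr_fun (hc.pow_right j).eq 1
  have h3 : ∀ q : Poly k, (mulOp (X (idx g)) ^ j : Module.End k (Poly k)) q = X (idx g) ^ j * q := by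
    intro q
    rw [mulOp, LinearMap.pow_mulLeft]; rfl
  rw [Module.End.mul_apply, Module.End.mul_apply, h3, h3, mul_one] at h2
  rw [h2, mul_comm]
  rfl

variable [CharZero k]

/-- Separate one variable. -/
def separate (x : Fin 5) : Poly k →ₐ[k] Polynomial (Poly k) :=
  aeval fun i => if i = x then Polynomial.X else Polynomial.C (X i)

theorem separate_eq_C {x : Fin 5} {p : Poly k} (h : pderiv x p = 0) :
    separate x p = Polynomial.C p := by
  conv_lhs => rw [p.as_sum]
  conv_rhs => rw [p.as_sum]
  rw [map_sum, map_sum]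
  refine Finset.sum_congr rfl fun e he => ?_
  have hx : e x = 0 := by
    by_contra hne
    exact (mem_support_iff.1 he) (coeff_eq_zero_of_pderiv_eq_zero h hne)
  rw [separate, aeval_monomial, monomial_eq, map_mul, Finsupp.prod, Finsupp.prod, map_prod]
  congr 1
  refine Finset.prod_congr rfl fun i hi => ?_
  have : i ≠ x := fun hix => by
    rw [Finsupp.mem_support_iff, hix] at hi
    exact hi hx
  simp [this]

/-- Symbols of the coefficients do not involve the new variable. Separating it turns Σ rⱼxʲ into a
one-variable polynomial whose coefficients are the symbols of the rⱼ. -/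
theorem oreMap_chain_injective (g : Gen) (f : ℕ →₀ chain k (rank g))
    (hf : oreMap (chain k (rank g)) (gen k g) f = 0) : f = 0 := by
  have hd : ∀ r ∈ chain k (rank g), pderiv (idx g) (toPoly r) = 0 := fun r hr => by
    have h := LinearMap.congr_fun
      (rep_commute_of_mem_chain (fun h hh => leftOp_commute_dOp (g := g) hh) hr).eq 1
    rw [Module.End.mul_apply, Module.End.mul_apply] at h
    have h1 : dOp (idx g) (1 : Poly k) = 0 := pderiv_one
    rw [h1, map_zero] at h
    exact h.symm
  have h := congrArg (fun y => separate (idx g) (toPoly y)) hf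
  simp only [oreMap_apply, Finsupp.sum, map_sum, map_zero] at h
  have h2 : ∑ j ∈ f.support, Polynomial.C (toPoly (f j : L k)) * Polynomial.X ^ j = 0 := by
    rw [← h]
    refine Finset.sum_congr rfl fun j _ => ?_
    rw [toPoly_mul_gen_pow (f j).2, map_mul, map_pow, separate_eq_C (hd _ (f j).2)]
    simp [separate]
  ext j
  by_cases hj : j ∈ f.support
  · have h3 := congrArg (fun P => Polynomial.coeff P j) h2
    simp only [Polynomial.finsetSum_coeff, Polynomial.coeff_C_mul_X_pow, Polynomial.coeff_zero] at h3
    rw [Finset.sum_ite_eq, if_pos hj] at h3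
    simpa using h3
  · simpa using hj

/-- The order c, a, b, z, w ensures that Δ(z) and Δ(w) involve, besides z and w themselves, only
generators adjoined earlier. -/
theorem isHopfSubalgebra_chain (i : ℕ) : IsHopfSubalgebra (chain k i) := by
  have hz : ∀ {g h : Gen}, rank g < i → rank h ≤ rank g → gen k h ∈ chain k i := fun hg hh =>
    gen_mem_chain (lt_of_le_of_lt hh hg)
  constructor
  · have key : chain k i ≤ (Algebra.TensorProduct.map (chain k i).val (chain k i).val).range.comap
        (Bialgebra.comulAlgHom k (L k)) := by
      have ht : ∀ {x y : L k}, x ∈ chain k i → y ∈ chain k i → x ⊗ₜ[k] y ∈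
          (Algebra.TensorProduct.map (chain k i).val (chain k i).val).range := fun {x y} hx hy =>
        ⟨⟨x, hx⟩ ⊗ₜ ⟨y, hy⟩, by simp⟩
      have h1 : (1 : L k) ∈ chain k i := Subalgebra.one_mem _
      refine chain_le fun g hg => ?_
      rw [Subalgebra.mem_comap, Bialgebra.comulAlgHom_apply, comul_gen]
      have hgg := gen_mem_chain (k := k) hg
      cases g
      · exact Subalgebra.add_mem _ (ht h1 hgg) (ht hgg h1)
      · exact Subalgebra.add_mem _ (ht h1 hgg) (ht hgg h1)
      · exact Subalgebra.add_mem _ (ht h1 hgg) (ht hgg h1)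
      · have ha := hz (h := .a) hg (by simp [rank])
        have hc := hz (h := .c) hg (by simp [rank])
        exact Subalgebra.add_mem _ (Subalgebra.sub_mem _ (Subalgebra.add_mem _ (ht h1 hgg) (ht ha hc))
          (ht hc ha)) (ht hgg h1)
      · have hb := hz (h := .b) hg (by simp [rank])
        have hc := hz (h := .c) hg (by simp [rank])
        exact Subalgebra.add_mem _ (Subalgebra.sub_mem _ (Subalgebra.add_mem _ (ht h1 hgg) (ht hb hc))
          (ht hc hb)) (ht hgg h1)
    rintro _ ⟨f, hf, rfl⟩
    obtain ⟨t, ht⟩ := key hf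
    exact ⟨t, ht⟩
  · have key : chain k i ≤ (chain k i).op.comap antipodeHom := chain_le fun g hg => by
      have : antipodeHom (gen k g) = MulOpposite.op (-gen k g) := by simp [antipodeHom]
      rw [Subalgebra.mem_comap, this, Subalgebra.mem_op, MulOpposite.unop_op]
      exact Subalgebra.neg_mem _ (gen_mem_chain hg)
    intro f hf
    exact Subalgebra.mem_op.1 (Subalgebra.mem_comap _ _ _ |>.1 (key hf))

theorem isOreExtension_chain (g : Gen) : IsOreExtension (chain k (rank g)) (chain k (rank g + 1)) := by
  refine isOreExtension_of_commutator_mem (x := gen k g)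
    (chain_le fun h hh => gen_mem_chain (hh.trans (Nat.lt_succ_self _)))
    (gen_mem_chain (Nat.lt_succ_self _)) (chain_le fun h hh => Algebra.subset_adjoin ?_)
    (fun r hr => commutator_mem_chain g hr) (oreMap_chain_injective g)
  rcases Nat.lt_succ_iff_lt_or_eq.1 hh with h' | h'
  · exact Or.inr (gen_mem_chain h')
  · exact Or.inl (by rw [rank_injective h'])

theorem isIHOE : IsIHOE k (L k) := by
  refine ⟨5, chain k, chain_zero, chain_five, fun i _ => isHopfSubalgebra_chain i, fun i hi => ?_⟩
  interval_cases i
  exacts [isOreExtension_chain .c, isOreExtension_chain .a, isOreExtension_chain .b,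
    isOreExtension_chain .z, isOreExtension_chain .w]

/-! ### Failure of cocommutativity -/

/-- Contracting the first leg of Δ(z) with the coefficient of a gives c, while the flipped coproduct
gives −c. -/
theorem not_isCocomm : ¬ Coalgebra.IsCocomm k (L k) := by
  intro h
  have h1 := Coalgebra.comm_comul k (z k)
  have h2 := congrArg (fun t => toPoly (contract (linCoeff 0) t)) h1
  have e : linCoeff 0 (a k) = 1 ∧ linCoeff 0 (c k) = 0 ∧ linCoeff 0 (z k) = 0 := by
    simp [linCoeff_apply, idx, pderiv_X]
  simp [comulGen, e, linCoeff_one, idx] at h2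
  have h3 : (2 : k) • (X 2 : Poly k) = 0 := by
    rw [two_smul]
    nth_rw 1 [← h2]
    simp
  rcases smul_eq_zero.1 h3 with h3 | h3
  · exact two_ne_zero h3
  · exact X_ne_zero 2 h3

end L

end ConnectedHopf

namespace ConnectedHopf

namespace L

open MvPolynomial

variable {k : Type u} [Field k]

/-! ### The Gelfand–Kirillov dimension -/

/-- The exponent vector bounded by `n` in each variable. -/
def boxExpo (n : ℕ) (e : Fin 5 → Fin (n + 1)) : Fin 5 →₀ ℕ :=
  Finsupp.equivFunOnFinite.symm fun i => (e i : ℕ)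

theorem boxExpo_injective (n : ℕ) : Function.Injective (boxExpo n) := fun e e' h => by
  funext i
  exact Fin.ext (DFunLike.congr_fun h i)

variable (k) in
/-- The span of the normally ordered monomials with all exponents at most `n`. -/
def box (n : ℕ) : Submodule k (L k) :=
  Submodule.span k (Set.range fun e : Fin 5 → Fin (n + 1) => toPoly.symm (monomial (boxExpo n e) (1 : k)))

theorem finrank_box (n : ℕ) : Module.finrank k (box k n) = (n + 1) ^ 5 := by
  have h : LinearIndependent k
      fun e : Fin 5 → Fin (n + 1) => (toPoly.symm (monomial (boxExpo n e) (1 : k)) : L k) := by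
    have h1 := ((basisMonomials (Fin 5) k).linearIndependent.comp _ (boxExpo_injective n)).map'
      toPoly.symm.toLinearMap toPoly.symm.ker
    exact h1
  rw [box, finrank_span_eq_card h]
  simp

instance (n : ℕ) : FiniteDimensional k (box k n) :=
  FiniteDimensional.span_of_finite k (Set.finite_range _)

/-- All weights are at least 1, so a weight bound bounds every exponent. -/
theorem fil_le_box (n : ℕ) : fil k n ≤ box k n := by
  intro f hf
  rw [eq_sum_mono f]
  refine Submodule.sum_mem _ fun e he => Submodule.smul_mem _ _ (Submodule.subset_span ?_)
  have hw := mem_below.1 hf e (mem_support_iff.1 he)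
  have hle : ∀ i, e i < n + 1 := fun i =>
    lt_of_le_of_lt (Finsupp.le_weight wt (s := i) (by revert i; decide) e) hw
  refine ⟨fun i => ⟨e i, hle i⟩, ?_⟩
  have : boxExpo n (fun i => ⟨e i, hle i⟩) = e := by ext i; rfl
  simp only [this]
  exact toPoly_symm_monomial e

theorem exists_le_fil (V : Submodule k (L k)) [FiniteDimensional k V] : ∃ d, V ≤ fil k d := by
  obtain ⟨S, hS⟩ := (Submodule.fg_iff_finiteDimensional V).2 inferInstance
  have h : ∀ f : L k, ∃ d, f ∈ fil k d := fun f => by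
    obtain ⟨n, hn⟩ := exists_mem_below (toPoly f)
    exact ⟨n, below_mono (Nat.le_succ n) hn⟩
  choose d hd using h
  refine ⟨S.sup d, ?_⟩
  rw [← hS, Submodule.span_le]
  exact fun f hf => fil_mono (Finset.le_sup hf) (hd f)

theorem iSup_pow_le_box {V : Submodule k (L k)} {d : ℕ} (hV : V ≤ fil k d) (n : ℕ) :
    (⨆ i ∈ Finset.range (n + 1), V ^ i : Submodule k (L k)) ≤ box k (n * d) := by
  have hpow : ∀ i, V ^ i ≤ fil k (i * d) := by
    intro i
    induction i with
    | zero => simpa using Submodule.one_le.2 (one_mem_fil (k := k))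
    | succ i ih =>
      rw [pow_succ, Submodule.mul_le, add_mul, one_mul]
      exact fun f hf g hg => mul_mem_fil _ _ _ (ih hf) _ (hV hg)
  refine iSup₂_le fun i hi => (hpow i).trans ((fil_mono ?_).trans (fil_le_box _))
  exact Nat.mul_le_mul_right d (Nat.lt_succ_iff.1 (Finset.mem_range.1 hi))

variable (k) in
/-- The span of `1` and the generators. -/
def genSpan : Submodule k (L k) := Submodule.span k (insert 1 (Set.range (gen k)))

instance : Finite Gen :=
  Finite.of_injective idx fun g h => by cases g <;> cases h <;> simp [idx]

instance : FiniteDimensional k (genSpan k) :=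
  FiniteDimensional.span_of_finite k ((Set.finite_range _).insert 1)

/-- A monomial with exponents at most m is a product of at most 5m generators. -/
theorem box_le_iSup_pow (m n : ℕ) (h : 5 * m ≤ n) :
    box k m ≤ (⨆ i ∈ Finset.range (n + 1), genSpan k ^ i : Submodule k (L k)) := by
  rw [box, Submodule.span_le]
  rintro _ ⟨e, rfl⟩
  set d := boxExpo m e with hd
  have h1 := map_mono_mem (𝓖 := fun n => genSpan k ^ n)
    (by rw [pow_zero]; exact Submodule.mem_one.2 ⟨1, map_one _⟩)
    (fun i j x hx y hy => by rw [pow_add]; exact Submodule.mul_mem_mul hx hy)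
    (AlgHom.id k (L k)) (fun _ => 1) (fun g => by
      rw [pow_one]; exact Submodule.subset_span (Or.inr ⟨g, rfl⟩)) d
  rw [AlgHom.id_apply, ← toPoly_symm_monomial] at h1
  have hle : ∀ i, d i ≤ m := fun i => Nat.lt_succ_iff.1 (e i).2
  have hw : Finsupp.weight (fun _ => 1) d < n + 1 := by
    rw [weight_eq]
    have := hle 0; have := hle 1; have := hle 2; have := hle 3; have := hle 4
    omega
  exact (le_iSup₂_of_le (f := fun i (_ : i ∈ Finset.range (n + 1)) => genSpan k ^ i) _
    (Finset.mem_range.2 hw) le_rfl) h1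

theorem tendsto_five_add_div_log (C : ℝ) :
    Filter.Tendsto (fun n : ℕ => ((5 + C / Real.log n : ℝ) : EReal)) Filter.atTop (nhds 5) := by
  have h : Filter.Tendsto (fun n : ℕ => 5 + C / Real.log n) Filter.atTop (nhds (5 + 0)) :=
    tendsto_const_nhds.add (Filter.Tendsto.const_div_atTop
      (Real.tendsto_log_atTop.comp tendsto_natCast_atTop_atTop) C)
  rw [add_zero] at h
  exact (continuous_coe_real_ereal.tendsto 5).comp h

theorem gkdim_le : GKdim k (L k) ≤ 5 := by
  refine iSup₂_le fun V hV => ?_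
  obtain ⟨d, hd⟩ := exists_le_fil V
  -- Since nd + 1 ≤ (d + 1)n for n ≥ 1, the box bound makes the quotient at most 5 + 5 log(d +
  -- 1)/log n.
  rw [← (tendsto_five_add_div_log (5 * Real.log (d + 1))).limsup_eq]
  refine Filter.limsup_le_limsup ?_
  filter_upwards [Filter.eventually_ge_atTop 2] with n hn
  rw [EReal.coe_le_coe_iff]
  set r := Module.finrank k (⨆ i ∈ Finset.range (n + 1), V ^ i : Submodule k (L k)) with hr
  have hr1 : r ≤ (n * d + 1) ^ 5 := by
    rw [← finrank_box (k := k)]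
    exact Submodule.finrank_mono (iSup_pow_le_box hd n)
  have hn' : (2 : ℝ) ≤ n := by exact_mod_cast hn
  have hlog : 0 < Real.log n := Real.log_pos (by linarith)
  have hd0 : (0 : ℝ) ≤ d := Nat.cast_nonneg d
  have hlogr : Real.log r ≤ 5 * (Real.log (d + 1) + Real.log n) := by
    rw [← Real.log_mul (by positivity) (by positivity)]
    have h5 : (5 : ℝ) * Real.log ((d + 1) * n) = Real.log (((d + 1) * n) ^ 5) := by
      rw [Real.log_pow]; norm_num
    rw [h5]
    rcases Nat.eq_zero_or_pos r with h0 | h0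
    · rw [h0, Nat.cast_zero, Real.log_zero]
      exact Real.log_nonneg (one_le_pow₀ (by nlinarith))
    · refine Real.log_le_log (by exact_mod_cast h0) ?_
      calc (r : ℝ) ≤ ((n * d + 1 : ℕ) : ℝ) ^ 5 := by exact_mod_cast hr1
        _ ≤ ((d + 1) * n) ^ 5 := by
          push_cast
          exact pow_le_pow_left₀ (by positivity) (by nlinarith) 5
  rw [div_le_iff₀ hlog, add_mul, div_mul_cancel₀ _ hlog.ne']
  linarith

theorem le_gkdim : 5 ≤ GKdim k (L k) := by
  refine le_trans ?_ (le_iSup₂_of_le (genSpan k) inferInstance le_rfl)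
  -- A box with exponents up to ⌊n/5⌋ fits, and (⌊n/5⌋ + 1)⁵ ≥ (n/5)⁵.
  rw [← (tendsto_five_add_div_log (-(5 * Real.log 5))).limsup_eq]
  refine Filter.limsup_le_limsup ?_
  filter_upwards [Filter.eventually_ge_atTop 2] with n hn
  rw [EReal.coe_le_coe_iff]
  set W := (⨆ i ∈ Finset.range (n + 1), genSpan k ^ i : Submodule k (L k)) with hW
  have hr1 : (n / 5 + 1) ^ 5 ≤ Module.finrank k W := by
    obtain ⟨d, hd⟩ := exists_le_fil (genSpan k)
    have : FiniteDimensional k W := Submodule.finiteDimensional_of_le (iSup_pow_le_box hd n)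
    rw [← finrank_box (k := k)]
    exact Submodule.finrank_mono (box_le_iSup_pow _ _ (Nat.mul_div_le n 5))
  have hn' : (2 : ℝ) ≤ n := by exact_mod_cast hn
  have hlog : 0 < Real.log n := Real.log_pos (by linarith)
  have hlogr : 5 * (Real.log n - Real.log 5) ≤ Real.log (Module.finrank k W) := by
    rw [← Real.log_div (by positivity) (by norm_num)]
    have h5 : (5 : ℝ) * Real.log (n / 5) = Real.log ((n / 5) ^ 5) := by
      rw [Real.log_pow]; norm_num
    rw [h5]
    refine Real.log_le_log (by positivity) ?_
    calc ((n : ℝ) / 5) ^ 5 ≤ ((n / 5 + 1 : ℕ) : ℝ) ^ 5 := by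
          refine pow_le_pow_left₀ (by positivity) ?_ 5
          rw [div_le_iff₀ (by norm_num)]
          have : n ≤ (n / 5 + 1) * 5 := by omega
          exact_mod_cast this
      _ ≤ _ := by exact_mod_cast hr1
  rw [le_div_iff₀ hlog, add_mul, div_mul_cancel₀ _ hlog.ne']
  linarith

theorem gkdim_eq : GKdim k (L k) = 5 := le_antisymm gkdim_le le_gkdim

end L

end ConnectedHopf

namespace ConnectedHopf

namespace L

open MvPolynomial

variable {k : Type u} [Field k]

/-! ### Reduction modulo `c` and its Poisson bracket -/

/-- Setting the variable `c` to zero. -/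
def killC : Poly k →ₐ[k] Poly k := aeval fun i => if i = 2 then 0 else X i

@[simp] theorem killC_X (i : Fin 5) : killC (X i : Poly k) = if i = 2 then 0 else X i := by
  simp [killC]

theorem exists_eq_killC_add (p : Poly k) : ∃ q, p = killC p + X 2 * q := by
  induction p using MvPolynomial.induction_on with
  | C r => exact ⟨0, by simp [killC]⟩
  | add p q hp hq =>
    obtain ⟨p', hp⟩ := hp
    obtain ⟨q', hq⟩ := hq
    refine ⟨p' + q', ?_⟩
    rw [map_add]
    linear_combination hp + hq
  | mul_X p i hp =>
    obtain ⟨p', hp⟩ := hp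
    rw [map_mul, killC_X]
    split_ifs with h
    · exact ⟨p, by rw [h]; ring⟩
    · exact ⟨p' * X i, by linear_combination X i * hp⟩

theorem killC_pderiv {i : Fin 5} (hi : i ≠ 2) (p : Poly k) :
    killC (pderiv i p) = pderiv i (killC p) := by
  induction p using MvPolynomial.induction_on with
  | C r => simp [killC]
  | add p q hp hq => simp [hp, hq]
  | mul_X p j hp =>
    by_cases h2 : j = 2
    · subst h2
      have : pderiv i (X 2 : Poly k) = 0 := pderiv_X_of_ne (Ne.symm hi)
      simp [Derivation.leibniz, hp, this]
    · by_cases hij : j = i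
      · subst hij; simp [Derivation.leibniz, hp, h2]
      · have : pderiv i (X j : Poly k) = 0 := pderiv_X_of_ne hij
        simp [Derivation.leibniz, hp, h2, this]

theorem pderiv_two_killC (p : Poly k) : pderiv 2 (killC p) = 0 := by
  induction p using MvPolynomial.induction_on with
  | C r => simp [killC]
  | add p q hp hq => simp [hp, hq]
  | mul_X p j hp =>
    by_cases h2 : j = 2
    · simp [h2]
    · have : pderiv 2 (X j : Poly k) = 0 := pderiv_X_of_ne h2
      simp [Derivation.leibniz, hp, h2, this]

theorem constantCoeff_killC (p : Poly k) : constantCoeff (killC p) = constantCoeff p := by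
  obtain ⟨q, hq⟩ := exists_eq_killC_add p
  conv_rhs => rw [hq]
  simp

/-- The reduction of `L` modulo `c`, with values in commutative polynomials. -/
def modC : L k →ₐ[k] Poly k :=
  lift (fun g => killC (X (idx g))) (by
    intro x y h
    cases h <;> simp [free, idx, mul_comm])

/-- Every correction term in `leftOp` has a factor c, so after setting c = 0 the action is plain
multiplication. -/
theorem modC_eq (f : L k) : modC f = killC (toPoly f) := by
  suffices h : ∀ p : Poly k, killC (rep f p) = modC f * killC p by
    simpa [toPoly_apply] using (h 1).symm
  induction f using L.induction with
  | halg r => intro p; simp [Algebra.algebraMap_eq_smul_one]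
  | hgen g =>
    intro p
    rw [rep_gen, modC, lift_gen]
    cases g <;> simp [idx]
  | hmul x y hx hy => intro p; simp [hx, hy, mul_assoc]
  | hadd x y hx hy => intro p; simp [hx, hy, add_mul]

@[simp] theorem modC_gen (g : Gen) : modC (gen k g) = killC (X (idx g)) := lift_gen _ _ g

theorem exists_eq_c_mul {f : L k} (h : modC f = 0) : ∃ g, f = c k * g := by
  obtain ⟨q, hq⟩ := exists_eq_killC_add (toPoly f)
  rw [← modC_eq, h, zero_add] at hq
  exact ⟨toPoly.symm q, toPoly.injective (by rw [toPoly_c_mul, LinearEquiv.apply_symm_apply, hq])⟩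

/-- The Poisson bracket `∂a ∧ ∂b`. -/
def bracket (p q : Poly k) : Poly k := pderiv 0 p * pderiv 1 q - pderiv 1 p * pderiv 0 q

/-- Commutators are divisible by `c`, and the quotients reduce to the Poisson bracket. -/
theorem exists_commutator_eq (f g : L k) :
    ∃ y, f * g - g * f = c k * y ∧ modC y = bracket (modC f) (modC g) := by
  induction f using L.induction with
  | halg r => exact ⟨0, by rw [Algebra.commutes]; simp, by simp [bracket]⟩
  | hgen h =>
    cases h
    · refine ⟨toPoly.symm (pderiv 1 (toPoly g)), toPoly.injective ?_, ?_⟩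
      · rw [toPoly_a_comm, toPoly_c_mul, LinearEquiv.apply_symm_apply]
      · rw [modC_eq, LinearEquiv.apply_symm_apply, killC_pderiv (by decide), ← modC_eq]
        simp [bracket, idx, pderiv_X]
    · refine ⟨toPoly.symm (-pderiv 0 (toPoly g)), toPoly.injective ?_, ?_⟩
      · rw [toPoly_b_comm, toPoly_c_mul, LinearEquiv.apply_symm_apply, mul_neg]
      · rw [modC_eq, LinearEquiv.apply_symm_apply, map_neg, killC_pderiv (by decide), ← modC_eq]
        simp [bracket, idx, pderiv_X]
    · exact ⟨0, by rw [← c_mul_comm]; simp, by simp [bracket, idx]⟩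
    -- The commutator carries c³, so c² survives division by c and vanishes modulo c: z, and
    -- likewise w, is Poisson central.
    · refine ⟨toPoly.symm (C (3 : k)⁻¹ * (X 2 ^ 2 * pderiv 4 (toPoly g))), toPoly.injective ?_, ?_⟩
      · rw [toPoly_z_comm, toPoly_c_mul, LinearEquiv.apply_symm_apply]
        ring
      · rw [modC_eq, LinearEquiv.apply_symm_apply]
        simp [bracket, idx, pderiv_X]
    · refine ⟨toPoly.symm (-(C (3 : k)⁻¹ * (X 2 ^ 2 * pderiv 3 (toPoly g)))), toPoly.injective ?_, ?_⟩
      · rw [toPoly_w_comm, toPoly_c_mul, LinearEquiv.apply_symm_apply]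
        ring
      · rw [modC_eq, LinearEquiv.apply_symm_apply]
        simp [bracket, idx, pderiv_X]
  | hmul x y hx hy =>
    obtain ⟨u, hu, hu'⟩ := hx
    obtain ⟨v, hv, hv'⟩ := hy
    refine ⟨x * v + u * y, ?_, ?_⟩
    · have e : x * y * g - g * (x * y) = x * (y * g - g * y) + (x * g - g * x) * y := by noncomm_ring
      rw [e, hu, hv, mul_add, ← mul_assoc x, ← c_mul_comm x, mul_assoc, mul_assoc]
    · simp only [map_add, map_mul, hu', hv', bracket, Derivation.leibniz, smul_eq_mul]
      ring
  | hadd x y hx hy =>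
    obtain ⟨u, hu, hu'⟩ := hx
    obtain ⟨v, hv, hv'⟩ := hy
    refine ⟨u + v, ?_, ?_⟩
    · rw [mul_add (c k), ← hu, ← hv]; noncomm_ring
    · simp only [map_add, hu', hv', bracket]
      ring

theorem linCoeff_eq_modC {i : Fin 5} (hi : i ≠ 2) (f : L k) :
    linCoeff i f = constantCoeff (pderiv i (modC f)) := by
  rw [linCoeff_apply, modC_eq, ← killC_pderiv hi, constantCoeff_killC]

theorem linCoeff_c_mul {i : Fin 5} (hi : i ≠ 2) (f : L k) : linCoeff i (c k * f) = 0 := by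
  have : pderiv i (X 2 : Poly k) = 0 := pderiv_X_of_ne (Ne.symm hi)
  rw [linCoeff_apply, toPoly_c_mul]
  simp [Derivation.leibniz, this]

theorem linCoeff_two_c_mul (f : L k) : linCoeff 2 (c k * f) = constantCoeff (modC f) := by
  rw [linCoeff_apply, toPoly_c_mul, modC_eq, constantCoeff_killC]
  simp [Derivation.leibniz]

/-- The projection of `L` onto the span of `a, b, c`. -/
def linPart : L k →ₗ[k] L k :=
  (linCoeff 0).smulRight (a k) + (linCoeff 1).smulRight (b k) + (linCoeff 2).smulRight (c k)

theorem linPart_apply (f : L k) :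
    linPart f = linCoeff 0 f • a k + linCoeff 1 f • b k + linCoeff 2 f • c k := rfl

theorem linPart_commutator (f g : L k) :
    linPart f * linPart g - linPart g * linPart f =
      (linCoeff 0 f * linCoeff 1 g - linCoeff 1 f * linCoeff 0 g) • c k := by
  simp only [linPart_apply, mul_add, add_mul, smul_mul_assoc, mul_smul_comm, ba, ca, cb]
  module

/-- Taking linear parts is a homomorphism for the commutator bracket. -/
theorem linPart_map_commutator (f g : L k) :
    linPart (f * g - g * f) = linPart f * linPart g - linPart g * linPart f := by
  obtain ⟨y, hy, hy'⟩ := exists_commutator_eq f g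
  rw [linPart_commutator, linPart_apply, hy, linCoeff_c_mul (by decide), linCoeff_c_mul (by decide),
    linCoeff_two_c_mul, hy']
  simp [bracket, linCoeff_eq_modC]

/-! ### `L` is not an enveloping algebra -/

/-- Combinations of the linear coefficients at a and b are point derivations, so one vanishing on a
generating set vanishes identically. Hence the coefficient pairs of elements of N span k². -/
theorem exists_linCoeff_det_ne_zero {N : Set (L k)} (hN : Algebra.adjoin k N = ⊤) :
    ∃ u ∈ N, ∃ v ∈ N, linCoeff 0 u * linCoeff 1 v - linCoeff 1 u * linCoeff 0 v ≠ 0 := by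
  have key : ∀ α β : k, (∀ f ∈ N, α * linCoeff 0 f + β * linCoeff 1 f = 0) → α = 0 ∧ β = 0 := by
    intro α β h
    have hall : ∀ f : L k, α * linCoeff 0 f + β * linCoeff 1 f = 0 := by
      intro f
      have hf : f ∈ Algebra.adjoin k N := hN ▸ Algebra.mem_top
      induction hf using Algebra.adjoin_induction with
      | mem f hf => exact h f hf
      | algebraMap r => simp [linCoeff_apply]
      | add f g _ _ hf hg =>
        rw [map_add, map_add]
        linear_combination hf + hg
      | mul f g _ _ hf hg =>
        simp only [linCoeff_eq_modC (show (0 : Fin 5) ≠ 2 by decide),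
          linCoeff_eq_modC (show (1 : Fin 5) ≠ 2 by decide), map_mul, map_add, Derivation.leibniz,
          smul_eq_mul] at hf hg ⊢
        linear_combination constantCoeff (modC f) * hg + constantCoeff (modC g) * hf
    have ha := hall (a k)
    have hb := hall (b k)
    simp [linCoeff_apply, idx, pderiv_X] at ha hb
    exact ⟨ha, hb⟩
  by_contra! hdet
  by_cases h0 : ∀ u ∈ N, linCoeff 0 u = 0
  · exact one_ne_zero (key 1 0 fun f hf => by rw [h0 f hf]; simp).1
  · push Not at h0
    obtain ⟨u, hu, hu0⟩ := h0
    refine hu0 (neg_eq_zero.1 (key (linCoeff 1 u) (-linCoeff 0 u) fun v hv => ?_).2)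
    linear_combination -(hdet u hu v hv)

variable [CharZero k]

theorem eq_C_of_pderiv_eq_zero {p : Poly k} (h : ∀ i, pderiv i p = 0) : p = C (constantCoeff p) :=
  eq_C_of_mem_below_one (mem_below_of_pderiv (n := 0) fun i => by
    rw [h i]; exact Submodule.zero_mem _)

/-- An element commuting with `z`, `w` and two elements with nonzero Poisson bracket is a scalar
modulo `c`. -/
theorem exists_eq_algebraMap_add {A B f : L k} (hAB : bracket (modC A) (modC B) ≠ 0)
    (hz : Commute (z k) f) (hw : Commute (w k) f) (hA : Commute A f) (hB : Commute B f) :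
    ∃ (r : k) (g : L k), f = algebraMap k (L k) r + c k * g ∧ modC f = C r ∧
      Commute (z k) g ∧ Commute (w k) g ∧ Commute A g ∧ Commute B g := by
  have hbr : ∀ {D : L k}, Commute D f → bracket (modC D) (modC f) = 0 := fun {D} hD => by
    obtain ⟨y, hy, hy'⟩ := exists_commutator_eq D f
    rw [hD.eq, sub_self] at hy
    have : y = 0 := c_mul_left_cancel (by rw [← hy, mul_zero])
    rw [← hy', this, map_zero]
  have h1 := hbr hA
  have h2 := hbr hB
  unfold bracket at h1 h2 hAB
  -- Cramer's rule: vanishing brackets with A and B form a linear system for ∂_a and ∂_b of f with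
  -- determinant the bracket of A and B. Commuting with w and z removes ∂_z and ∂_w.
  have hC : modC f = C (constantCoeff (modC f)) := by
    refine eq_C_of_pderiv_eq_zero fun i => ?_
    fin_cases i
    · refine (mul_eq_zero.1 ?_).resolve_left hAB
      change _ * pderiv 0 (modC f) = 0
      linear_combination (pderiv 0 (modC B)) * h1 - (pderiv 0 (modC A)) * h2
    · refine (mul_eq_zero.1 ?_).resolve_left hAB
      change _ * pderiv 1 (modC f) = 0
      linear_combination (pderiv 1 (modC B)) * h1 - (pderiv 1 (modC A)) * h2
    · change pderiv 2 (modC f) = 0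
      rw [modC_eq, pderiv_two_killC]
    · change pderiv 3 (modC f) = 0
      rw [modC_eq, ← killC_pderiv (by decide), pderiv_toPoly_of_commute_w hw, map_zero]
    · change pderiv 4 (modC f) = 0
      rw [modC_eq, ← killC_pderiv (by decide), pderiv_toPoly_of_commute_z hz, map_zero]
  set r := constantCoeff (modC f)
  obtain ⟨g, hg⟩ := exists_eq_c_mul (f := f - algebraMap k (L k) r) (by
    rw [map_sub, AlgHom.commutes, sub_eq_zero, hC]; rfl)
  -- As c is central and cancellable, g inherits the commutations of f, and the argument can be
  -- iterated.
  have hcomm : ∀ {D : L k}, Commute D f → Commute D g := fun {D} hD => by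
    have h : Commute D (c k * g) := by
      rw [← hg]; exact hD.sub_right (Algebra.commutes r D).symm
    refine c_mul_left_cancel ?_
    have h' := h.eq
    rw [← mul_assoc, ← c_mul_comm D, mul_assoc, mul_assoc] at h'
    exact h'
  exact ⟨r, g, by rw [← hg]; abel, hC, hcomm hz, hcomm hw, hcomm hA, hcomm hB⟩

/-- No algebra endomorphism of `L` takes the elements of a generating set to their linear parts. -/
theorem not_forall_eq_linPart {N : Set (L k)} (hN : Algebra.adjoin k N = ⊤) (Φ : L k →ₐ[k] L k)
    (hΦ : ∀ f ∈ N, Φ f = linPart f) : False := by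
  have hΦc : Φ (c k) = Φ (a k) * Φ (b k) - Φ (b k) * Φ (a k) := by
    rw [← map_mul, ← map_mul, ← map_sub, ba, sub_sub_cancel]
  obtain ⟨y₀, hy₀, hy₀'⟩ := exists_commutator_eq (Φ (a k)) (Φ (b k))
  rw [← hΦc] at hy₀
  -- For u, v with nonzero determinant, applying Φ to [u, v] = cy and cancelling c makes y₀Φ(y) a
  -- nonzero scalar.
  have hne : modC y₀ ≠ 0 := by
    obtain ⟨u, hu, v, hv, hdet⟩ := exists_linCoeff_det_ne_zero hN
    obtain ⟨y, hy, -⟩ := exists_commutator_eq u v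
    have h1 := congrArg Φ hy
    rw [map_sub, map_mul, map_mul, hΦ u hu, hΦ v hv, linPart_commutator, map_mul, hy₀, mul_assoc] at h1
    have h2 : y₀ * Φ y = algebraMap k (L k) _ := c_mul_left_cancel (h1.symm.trans
      (by rw [c_mul_comm, ← Algebra.smul_def]))
    have h3 := congrArg modC h2
    rw [map_mul, AlgHom.commutes] at h3
    intro h0
    rw [h0, zero_mul] at h3
    exact hdet ((map_eq_zero (algebraMap k (Poly k))).1 h3.symm)
  -- The image of Φ lies in the algebra generated by a, b, c, which z and w centralize.
  have hcent : ∀ g : Gen, g = .z ∨ g = .w → ∀ f, Commute (gen k g) (Φ f) := by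
    intro g hg f
    have hf : f ∈ Algebra.adjoin k N := hN ▸ Algebra.mem_top
    induction hf using Algebra.adjoin_induction with
    | mem f hf =>
      rw [hΦ f hf, linPart_apply]
      rcases hg with rfl | rfl
      · exact (((show Commute (z k) (a k) from za).smul_right _).add_right
          ((show Commute (z k) (b k) from zb).smul_right _)).add_right
          ((show Commute (z k) (c k) from zc).smul_right _)
      · exact (((show Commute (w k) (a k) from wa).smul_right _).add_right
          ((show Commute (w k) (b k) from wb).smul_right _)).add_right
          ((show Commute (w k) (c k) from wc).smul_right _)
    | algebraMap r => rw [AlgHom.commutes]; exact (Algebra.commutes r _).symm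
    | add f g _ _ hf hg => rw [map_add]; exact hf.add_right hg
    | mul f g _ _ hf hg => rw [map_mul]; exact hf.mul_right hg
  have hJ : bracket (modC (Φ (a k))) (modC (Φ (b k))) ≠ 0 := hy₀' ▸ hne
  have hexp : ∀ f : L k, Commute (a k) f → Commute (b k) f →
      ∃ (r s : k) (g : L k), Φ f = algebraMap k (L k) r + c k * g ∧ modC g = C s := by
    intro f hfa hfb
    obtain ⟨r, g, hr, -, h1, h2, h3, h4⟩ := exists_eq_algebraMap_add hJ (hcent .z (Or.inl rfl) f)
      (hcent .w (Or.inr rfl) f) (hfa.map Φ) (hfb.map Φ)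
    obtain ⟨s, -, -, hs, -⟩ := exists_eq_algebraMap_add hJ h1 h2 h3 h4
    exact ⟨r, s, g, hr, hs⟩
  obtain ⟨r, s, g, hz, hg⟩ := hexp (z k) za.symm zb.symm
  obtain ⟨r', s', g', hw, hg'⟩ := hexp (w k) wa.symm wb.symm
  obtain ⟨y, hy, hy'⟩ := exists_commutator_eq g g'
  have h1 : Φ (z k) * Φ (w k) - Φ (w k) * Φ (z k) = (3 : k)⁻¹ • Φ (c k) ^ 3 := by
    rw [← map_mul, ← map_mul, ← map_sub, wz, sub_sub_cancel, map_smul, map_pow]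
  -- Scalars drop out of the commutator, leaving c²[g, g′], and [g, g′] contributes another factor
  -- c.
  have h2 : Φ (z k) * Φ (w k) - Φ (w k) * Φ (z k) = c k * (c k * (c k * y)) := by
    have e1 : ∀ t t' : L k, c k * t * (c k * t') = c k * (c k * (t * t')) := fun t t' => by
      rw [mul_assoc, ← mul_assoc t, ← c_mul_comm t, mul_assoc]
    rw [← hy, hz, hw, mul_sub, mul_sub, ← e1, ← e1, add_mul, mul_add, mul_add, add_mul, mul_add,
      mul_add, Algebra.commutes r (algebraMap k (L k) r'), Algebra.commutes r (c k * g'),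
      Algebra.commutes r' (c k * g)]
    abel
  have h3 : Φ (c k) ^ 3 = c k * (c k * (c k * y₀ ^ 3)) := by
    have hc : ∀ t t' : L k, t * (c k * t') = c k * (t * t') := fun t t' => by
      rw [← mul_assoc, ← c_mul_comm t, mul_assoc]
    rw [hy₀]
    simp only [pow_succ, pow_zero, one_mul, mul_assoc, hc]
  rw [h1, h3, ← mul_smul_comm, ← mul_smul_comm, ← mul_smul_comm] at h2
  -- After cancelling c³ and reducing modulo c, one side is the bracket of two scalars, so y₀³
  -- vanishes in a domain.
  have h4 := congrArg modC (c_mul_left_cancel (c_mul_left_cancel (c_mul_left_cancel h2)))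
  rw [hy', hg, hg', map_smul, map_pow] at h4
  have h5 : (3 : k)⁻¹ • modC y₀ ^ 3 = 0 := by simpa [bracket] using h4
  exact hne (pow_eq_zero_iff (three_ne_zero)|>.1
    ((smul_eq_zero.1 h5).resolve_left (inv_ne_zero three_ne_zero)))

attribute [local instance] LieRing.ofAssociativeRing

/-- The linear part is a Lie homomorphism, so by the universal property its restriction to 𝔫 would
extend to the endomorphism excluded by `not_forall_eq_linPart`. -/
theorem isEmpty_algEquiv_universalEnvelopingAlgebra (𝔫 : Type v) [LieRing 𝔫] [LieAlgebra k 𝔫] :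
    IsEmpty (L k ≃ₐ[k] UniversalEnvelopingAlgebra k 𝔫) := by
  refine ⟨fun E => ?_⟩
  let j : 𝔫 →ₗ⁅k⁆ L k := (E.symm.toAlgHom : _ →ₗ⁅k⁆ L k).comp (UniversalEnvelopingAlgebra.ι k)
  let θ : 𝔫 →ₗ⁅k⁆ L k :=
    { linPart ∘ₗ (j : 𝔫 →ₗ[k] L k) with
      map_lie' := fun {x y} => by
        have h : j ⁅x, y⁆ = j x * j y - j y * j x := by
          rw [LieHom.map_lie, LieRing.of_associative_ring_bracket]
        change linPart (j ⁅x, y⁆) = ⁅linPart (j x), linPart (j y)⁆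
        rw [h, linPart_map_commutator, LieRing.of_associative_ring_bracket] }
  have hθ : ∀ x, θ x = linPart (j x) := fun _ => rfl
  have hj : ∀ x, E (j x) = UniversalEnvelopingAlgebra.ι k x := fun x => E.apply_symm_apply _
  refine not_forall_eq_linPart (N := Set.range j) ?_
    ((UniversalEnvelopingAlgebra.lift k θ).comp E.toAlgHom) ?_
  -- The image of 𝔫 generates `L`: the universal map into S followed by the inclusion agrees with
  -- the inverse of E on 𝔫, hence everywhere.
  · set S := Algebra.adjoin k (Set.range j) with hS
    let j' : 𝔫 →ₗ⁅k⁆ S :=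
      { toFun := fun x => ⟨j x, Algebra.subset_adjoin ⟨x, rfl⟩⟩
        map_add' := fun x y => Subtype.ext (map_add j x y)
        map_smul' := fun r x => Subtype.ext (map_smul j r x)
        map_lie' := fun {x y} => Subtype.ext (by
          change j ⁅x, y⁆ = _
          rw [LieHom.map_lie, LieRing.of_associative_ring_bracket,
            LieRing.of_associative_ring_bracket]
          rfl) }
    have h : (S.val.comp (UniversalEnvelopingAlgebra.lift k j')) = E.symm.toAlgHom := by
      refine UniversalEnvelopingAlgebra.hom_ext k (LieHom.ext fun x => ?_)
      change ((UniversalEnvelopingAlgebra.lift k j' (UniversalEnvelopingAlgebra.ι k x) : S) : L k) = j x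
      rw [UniversalEnvelopingAlgebra.lift_ι_apply]
      rfl
    refine Algebra.eq_top_iff.2 fun f => ?_
    have hf := DFunLike.congr_fun h (E f)
    have hf' : (E.symm.toAlgHom : _ →ₐ[k] L k) (E f) = f := E.symm_apply_apply f
    rw [hf'] at hf
    rw [← hf]
    exact (UniversalEnvelopingAlgebra.lift k j' (E f)).2
  · rintro _ ⟨x, rfl⟩
    change UniversalEnvelopingAlgebra.lift k θ (E (j x)) = _
    rw [hj, UniversalEnvelopingAlgebra.lift_ι_apply]
    rfl

end L

end ConnectedHopf

end

/-! ### The properties of `L` assembled -/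

theorem theorem5p6 (k : Type u) [Field k] [IsAlgClosed k] [CharZero k] :
    -- the Hopf algebra structure of `L` on the generators
    (Coalgebra.comul (R := k) (ConnectedHopf.L.a k) =
        1 ⊗ₜ[k] ConnectedHopf.L.a k + ConnectedHopf.L.a k ⊗ₜ[k] 1 ∧
      Coalgebra.comul (R := k) (ConnectedHopf.L.b k) =
        1 ⊗ₜ[k] ConnectedHopf.L.b k + ConnectedHopf.L.b k ⊗ₜ[k] 1 ∧
      Coalgebra.comul (R := k) (ConnectedHopf.L.c k) =
        1 ⊗ₜ[k] ConnectedHopf.L.c k + ConnectedHopf.L.c k ⊗ₜ[k] 1 ∧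
      Coalgebra.comul (R := k) (ConnectedHopf.L.z k) =
        1 ⊗ₜ[k] ConnectedHopf.L.z k + ConnectedHopf.L.a k ⊗ₜ[k] ConnectedHopf.L.c k
          - ConnectedHopf.L.c k ⊗ₜ[k] ConnectedHopf.L.a k + ConnectedHopf.L.z k ⊗ₜ[k] 1 ∧
      Coalgebra.comul (R := k) (ConnectedHopf.L.w k) =
        1 ⊗ₜ[k] ConnectedHopf.L.w k + ConnectedHopf.L.b k ⊗ₜ[k] ConnectedHopf.L.c k
          - ConnectedHopf.L.c k ⊗ₜ[k] ConnectedHopf.L.b k + ConnectedHopf.L.w k ⊗ₜ[k] 1 ∧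
      ∀ g : ConnectedHopf.Gen,
        Coalgebra.counit (R := k) (ConnectedHopf.L.gen k g) = 0 ∧
        HopfAlgebra.antipode k (ConnectedHopf.L.gen k g) = -ConnectedHopf.L.gen k g) ∧
    -- it is not cocommutative
    ¬ Coalgebra.IsCocomm k (ConnectedHopf.L k) ∧
    -- `L` is a connected Hopf algebra
    ConnectedHopf.IsConnected k (ConnectedHopf.L k) ∧
    -- `L` is connected graded as an algebra, and a graded Hopf algebra for the same grading
    (∃ 𝒜 : ℕ → Submodule k (ConnectedHopf.L k),
      ConnectedHopf.IsConnectedGradedAlgebra 𝒜 ∧ ConnectedHopf.IsHopfGrading 𝒜) ∧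
    -- `L` is not isomorphic, as an algebra, to an enveloping algebra
    (∀ (𝔫 : Type v) [LieRing 𝔫] [LieAlgebra k 𝔫],
      IsEmpty (ConnectedHopf.L k ≃ₐ[k] UniversalEnvelopingAlgebra k 𝔫)) ∧
    -- `L` is an iterated Hopf Ore extension
    ConnectedHopf.IsIHOE k (ConnectedHopf.L k) ∧
    -- Gelfand–Kirillov dimension
    ConnectedHopf.GKdim k (ConnectedHopf.L k) = 5 ∧
    -- signature
    ConnectedHopf.HasSignature k (ConnectedHopf.L k) ![1, 1, 1, 2, 2] ∧
    -- the centre is the polynomial algebra `k[c]`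
    (Subalgebra.center k (ConnectedHopf.L k) = Algebra.adjoin k {ConnectedHopf.L.c k} ∧
      Transcendental k (ConnectedHopf.L.c k)) := by
  refine ⟨⟨ConnectedHopf.L.comul_gen _, ConnectedHopf.L.comul_gen _, ConnectedHopf.L.comul_gen _,
    ConnectedHopf.L.comul_gen _, ConnectedHopf.L.comul_gen _, fun g =>
      ⟨ConnectedHopf.L.counit_gen g, ConnectedHopf.L.antipodeLin_gen g⟩⟩,
    ConnectedHopf.L.not_isCocomm, ConnectedHopf.L.isConnected,
    ⟨ConnectedHopf.L.grading k, ConnectedHopf.L.isConnectedGradedAlgebra,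
      ConnectedHopf.L.isHopfGrading⟩,
    fun 𝔫 _ _ => ConnectedHopf.L.isEmpty_algEquiv_universalEnvelopingAlgebra 𝔫,
    ConnectedHopf.L.isIHOE, ConnectedHopf.L.gkdim_eq, ConnectedHopf.L.hasSignature,
    ConnectedHopf.L.center_eq, ConnectedHopf.L.transcendental_c⟩
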